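/- **Setting.** A linear map $\varphi\colon\mathcal B\to\mathcal C$ between C\*-algebras is a *complete contraction* if for every $k$ the entrywise map $M_k(\mathcal B)\to M_k(\mathcal C)$ is a contraction for the C\*-norms. Let $\beta$ be an automorphism (\*-automorphism) of a C\*-algebra $\mathcal B$ and let $\pi\colon\mathcal B\to B(H)$ be a faithful representation on a Hilbert space. For $\omega\subseteq\mathcal B$ and $\delta>0$ let $rcc(\omega,\delta)\in\{1,2,\dots\}\cup\{\infty\}$ be the smallest integer $m\ge 1$ for which there are complete contractions $\phi\colon\mathcal B\to\mathbb M_m$ and $\psi\colon\mathbb M_m\to B(H)$ with $\|\psi(\phi(b))-\pi(b)\|<\delta$ for all $b\in\omega$ (and $\infty$ if there is no such $m$). The completely contractive entropy of $\beta$ is $$ht'_{\mathcal B}(\beta)=\sup_{\omega}\ \sup_{\delta>0}\ \limsup_{n\to\infty}\frac1n\log rcc\Big(\bigcup_{i=0}^{n-1}\beta^i(\omega),\delta\Big)\in[0,\infty],$$ where $\omega$ runs over the finite subsets of $\mathcal B$. **Theorem 3.5.** Let $\mathcal A$ be a non-unital C\*-algebra (for instance an exact one; exactness is not needed with the above convention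 for $\infty$), let $\tilde{\mathcal A}$ be its unitization, and let $\alpha$ be an automorphism of $\mathcal A$. Then $\alpha$ has a unique extension to an automorphism $\tilde\alpha$ of $\tilde{\mathcal A}$, and $$ht'_{\mathcal A}(\alpha)=ht'_{\tilde{\mathcal A}}(\tilde\alpha),$$ where the two entropies may be computed in any faithful representations of $\mathcal A$ and of $\tilde{\mathcal A}$ whatsoever. -/

import Mathlib

open scoped ENNReal ComplexOrder

noncomputable section

/-- The norm on `M_k(A)`, the matrix algebra over a (possibly non-unital) C⋆-algebra `A`: the
norm that Mathlib puts on `CStarMatrix`, i.e. the unique one making `M_k(A)` a C⋆-algebra.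
Mathlib's construction wants `A` ordered by its positive cone, which is its canonical order. -/
def matrixNorm {A : Type*} [NonUnitalCStarAlgebra A] {k : ℕ}
    (M : CStarMatrix (Fin k) (Fin k) A) : ℝ :=
  letI := CStarAlgebra.spectralOrder A
  haveI := CStarAlgebra.spectralOrderedRing A
  ‖M‖

/-- A linear map `φ : A → B` between C⋆-algebras is a complete contraction if, for every `k`,
applying `φ` entrywise gives a contraction `M_k(A) → M_k(B)`. -/
def IsCompleteContraction {A B : Type*} [NonUnitalCStarAlgebra A] [NonUnitalCStarAlgebra B]
    (φ : A →ₗ[ℂ] B) : Prop :=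
  ∀ (k : ℕ) (M : CStarMatrix (Fin k) (Fin k) A), matrixNorm (M.map φ) ≤ matrixNorm M

variable {A : Type*} [NonUnitalCStarAlgebra A]
  {H : Type*} [NormedAddCommGroup H] [InnerProductSpace ℂ H] [CompleteSpace H]

/-- With `A` represented on `H` by `π`, the completely contractive rank `rcc(ω, δ)`: the smallest
`m ≥ 1` for which there are complete contractions `φ : A → M_m` and `ψ : M_m → B(H)` with
`‖ψ(φ(a)) - a‖ < δ` for all `a ∈ ω`, and `∞` if there is no such `m`. -/
def rcc (π : A →⋆ₙₐ[ℂ] (H →L[ℂ] H)) (ω : Set A) (δ : ℝ) : ℕ∞ :=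
  sInf {r : ℕ∞ | ∃ m : ℕ, 1 ≤ m ∧ r = (m : ℕ∞) ∧
    ∃ (φ : A →ₗ[ℂ] CStarMatrix (Fin m) (Fin m) ℂ)
      (ψ : CStarMatrix (Fin m) (Fin m) ℂ →ₗ[ℂ] (H →L[ℂ] H)),
      IsCompleteContraction φ ∧ IsCompleteContraction ψ ∧ ∀ a ∈ ω, ‖ψ (φ a) - π a‖ < δ}

/-- `limsup_n (1/n) log rcc(ω ∪ α(ω) ∪ ⋯ ∪ αⁿ⁻¹(ω), δ)`, in the extended reals. -/
def htAt (π : A →⋆ₙₐ[ℂ] (H →L[ℂ] H)) (α : A ≃⋆ₐ[ℂ] A) (ω : Finset A) (δ : ℝ) : EReal :=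
  Filter.limsup
    (fun n : ℕ => ENNReal.log ((rcc π (⋃ i < n, (⇑α)^[i] '' (ω : Set A)) δ : ℕ∞) : ℝ≥0∞) / n)
    Filter.atTop

/-- The supremum of `htAt` over `δ > 0`. -/
def htOn (π : A →⋆ₙₐ[ℂ] (H →L[ℂ] H)) (α : A ≃⋆ₐ[ℂ] A) (ω : Finset A) : EReal :=
  ⨆ (δ : ℝ) (_ : 0 < δ), htAt π α ω δ

/-- The completely contractive entropy of the automorphism `α` of `A`, where `A` is represented
on `H` by `π`: the supremum of `htOn` over all finite subsets `ω` of `A`. -/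
def ccEntropy (π : A →⋆ₙₐ[ℂ] (H →L[ℂ] H)) (α : A ≃⋆ₐ[ℂ] A) : EReal :=
  ⨆ ω : Finset A, htOn π α ω

end

/-! Restricting a factorization from the unitization to `A` costs nothing. Conversely, after
enlarging the finite set and shrinking the tolerance independently of `n`, adjoining a unit costs
one matrix dimension, and `log 2 / n → 0` erases that.

For the converse, let `T = ψ ∘ φ` approximate `π` on the first `n` translates of a finite set, let
`f` be an approximate unit for these translates, and put `c = T (f * f)`, `h = c⋆c`, `l = h ^ N`,
`l⋆l + k⋆k = 1`. Send `b = z + x` to `φ (f b f) ⊕ z`, and send `X ⊕ z` back to `l⋆ c⋆ ψ(X) l + z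
k⋆k`. The scalar part returns `z (1 - h^(2N) (1 - h))`, which is within `|z| / (2N + 1)` of `z`. The
rest is near `π x` once `c` and `c⋆` almost fix `π x` and `π x⋆` (`norm_completion_sub_le`).

The difficulty is that `f` depends on `n`, so `T (f * f)` is not controlled by the approximation,
and `T` need not be positive. The remedy is uniform convexity: put into the finite set a fixed
approximate unit `0 ≤ e ≤ 1`. Since `2e - f²` is nearly `f (2e - 1) f`, both `T (f²)` and `2 T e - T
(f²)` are nearly contractions, and their midpoint `T e ≈ π e` almost fixes `π x`. By the
parallelogram law `T (f²)` almost fixes it too (`norm_mul_sub_le_of_midpoint`).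

Independence of the representation rests on `exists_completeContraction_extension`: vector
functionals extend by Hahn–Banach, and their GNS representations, summed and compressed, extend any
representation of the unital subalgebra. Absence of a unit in `A` makes the unital extension of a
faithful representation faithful, so this applies to the unitization. -/

noncomputable section

/-! ### Matrix norms and permanence properties of complete contractions. -/

section MatrixNorm

variable {A B C : Type*} [NonUnitalCStarAlgebra A] [NonUnitalCStarAlgebra B]
  [NonUnitalCStarAlgebra C] {k : ℕ}
  {H : Type*} [NormedAddCommGroup H] [InnerProductSpace ℂ H] [CompleteSpace H]
  {K : Type*} [NormedAddCommGroup K] [InnerProductSpace ℂ K] [CompleteSpace K]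

theorem norm_apply_le_matrixNorm (F : CStarMatrix (Fin k) (Fin k) A →⋆ₙₐ[ℂ] C)
    (M : CStarMatrix (Fin k) (Fin k) A) : ‖F M‖ ≤ matrixNorm M := by
  let _ := CStarAlgebra.spectralOrder A
  have _ := CStarAlgebra.spectralOrderedRing A
  exact NonUnitalStarAlgHom.norm_apply_le F M

/-- Injective ⋆-homomorphisms of C⋆-algebras are isometric, so a matrix norm can be computed in any
faithful C⋆-image of the matrix algebra. -/
theorem norm_apply_eq_matrixNorm (F : CStarMatrix (Fin k) (Fin k) A →⋆ₙₐ[ℂ] C)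
    (hF : Function.Injective F) (M : CStarMatrix (Fin k) (Fin k) A) :
    ‖F M‖ = matrixNorm M := by
  let _ := CStarAlgebra.spectralOrder A
  have _ := CStarAlgebra.spectralOrderedRing A
  exact NonUnitalStarAlgHom.norm_map F hF M

theorem matrixNorm_map_le (f : A →⋆ₙₐ[ℂ] B) (M : CStarMatrix (Fin k) (Fin k) A) :
    matrixNorm (M.map f) ≤ matrixNorm M := by
  let _ := CStarAlgebra.spectralOrder B
  have _ := CStarAlgebra.spectralOrderedRing B
  exact norm_apply_le_matrixNorm (CStarMatrix.mapₙₐ f) M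

theorem matrixNorm_map_eq (f : A →⋆ₙₐ[ℂ] B) (hf : Function.Injective f)
    (M : CStarMatrix (Fin k) (Fin k) A) : matrixNorm (M.map f) = matrixNorm M := by
  let _ := CStarAlgebra.spectralOrder B
  have _ := CStarAlgebra.spectralOrderedRing B
  exact norm_apply_eq_matrixNorm (CStarMatrix.mapₙₐ f) (CStarMatrix.map_injective hf) M

/-- A matrix with operator entries, acting on the Hilbert space direct sum of copies of `H`. -/
def CStarMatrix.toOperator (k : ℕ) (H : Type*) [NormedAddCommGroup H] [InnerProductSpace ℂ H]
    [CompleteSpace H] :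
    CStarMatrix (Fin k) (Fin k) (H →L[ℂ] H) →⋆ₙₐ[ℂ]
      (PiLp 2 (fun _ : Fin k => H) →L[ℂ] PiLp 2 (fun _ : Fin k => H)) where
  toFun M := (PiLp.continuousLinearEquiv 2 ℂ (fun _ : Fin k => H)).symm.toContinuousLinearMap ∘L
    ContinuousLinearMap.pi (fun i => ∑ j, M i j ∘L PiLp.proj 2 (fun _ : Fin k => H) j)
  map_smul' c M := by
    ext x i; simp [Finset.smul_sum]
  map_zero' := by ext x i; simp
  map_add' M N := by ext x i; simp [Finset.sum_add_distrib]
  map_mul' M N := by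
    ext x i
    simp only [CStarMatrix.mul_apply, ContinuousLinearMap.coe_comp, Function.comp_apply,
      ContinuousLinearEquiv.coe_coe, PiLp.continuousLinearEquiv_symm_apply,
      ContinuousLinearMap.coe_pi', sum_apply, PiLp.proj_apply,
      mul_apply_eq_comp, map_sum]
    rw [Finset.sum_comm]
  map_star' M := by
    rw [ContinuousLinearMap.star_eq_adjoint, ContinuousLinearMap.eq_adjoint_iff]
    intro x y
    simp only [PiLp.inner_apply, ContinuousLinearMap.coe_comp, Function.comp_apply,
      ContinuousLinearEquiv.coe_coe, PiLp.continuousLinearEquiv_symm_apply,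
      ContinuousLinearMap.coe_pi', sum_apply, PiLp.proj_apply,
      sum_inner, inner_sum, CStarMatrix.star_apply, ContinuousLinearMap.star_eq_adjoint,
      ContinuousLinearMap.adjoint_inner_left]
    rw [Finset.sum_comm]

theorem CStarMatrix.toOperator_apply (M : CStarMatrix (Fin k) (Fin k) (H →L[ℂ] H))
    (x : PiLp 2 (fun _ : Fin k => H)) (i : Fin k) :
    CStarMatrix.toOperator k H M x i = ∑ j, M i j (x j) := by
  simp [CStarMatrix.toOperator]

theorem CStarMatrix.toOperator_injective :
    Function.Injective (CStarMatrix.toOperator k H) := by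
  intro M N h
  ext i j v
  have := congrArg (fun T => T (WithLp.toLp 2 (Pi.single j v)) i) h
  simp only [CStarMatrix.toOperator_apply] at this
  rw [Finset.sum_eq_single j, Finset.sum_eq_single j] at this
  · simpa using this
  all_goals first | (intro b _ hb; simp [hb]) | simp

theorem norm_toOperator (M : CStarMatrix (Fin k) (Fin k) (H →L[ℂ] H)) :
    ‖CStarMatrix.toOperator k H M‖ = matrixNorm M :=
  norm_apply_eq_matrixNorm (A := H →L[ℂ] H) (CStarMatrix.toOperator k H)
    CStarMatrix.toOperator_injective M

/-- A ⋆-homomorphism of C⋆-algebras, as a linear map. -/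
def NonUnitalStarAlgHom.toLinear (f : A →⋆ₙₐ[ℂ] B) : A →ₗ[ℂ] B := f

theorem matrixNorm_oneByOne (a : A) :
    matrixNorm (k := 1) (CStarMatrix.ofMatrix fun _ _ => a) = ‖a‖ := by
  let _ := CStarAlgebra.spectralOrder A
  have _ := CStarAlgebra.spectralOrderedRing A
  let F : A →⋆ₙₐ[ℂ] CStarMatrix (Fin 1) (Fin 1) A :=
    { toFun a := CStarMatrix.ofMatrix fun _ _ => a
      map_smul' _ _ := rfl
      map_zero' := rfl
      map_add' _ _ := rfl
      map_mul' _ _ := by ext; simp [CStarMatrix.mul_apply]; rfl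
      map_star' _ := rfl }
  have hF : Function.Injective F := fun a b h => congrFun (congrFun h 0) 0
  exact NonUnitalStarAlgHom.norm_map F hF a

theorem norm_toLp_map_le {H' K' : Type*} [NormedAddCommGroup H'] [InnerProductSpace ℂ H']
    [NormedAddCommGroup K'] [InnerProductSpace ℂ K'] {V : H' →L[ℂ] K'} (hV : ‖V‖ ≤ 1)
    (y : PiLp 2 (fun _ : Fin k => H')) :
    ‖(WithLp.toLp 2 fun i => V (y i) : PiLp 2 (fun _ : Fin k => K'))‖ ≤ ‖y‖ := by
  rw [PiLp.norm_eq_of_L2, PiLp.norm_eq_of_L2]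
  refine Real.sqrt_le_sqrt (Finset.sum_le_sum fun i _ => ?_)
  have := V.le_of_opNorm_le hV (y i)
  rw [one_mul] at this
  exact pow_le_pow_left₀ (norm_nonneg _) this 2

namespace IsCompleteContraction

theorem comp {ψ : B →ₗ[ℂ] C} {φ : A →ₗ[ℂ] B} (hψ : IsCompleteContraction ψ)
    (hφ : IsCompleteContraction φ) : IsCompleteContraction (ψ ∘ₗ φ) := fun k M =>
  (hψ k (M.map φ)).trans (hφ k M)

theorem of_starHom (f : A →⋆ₙₐ[ℂ] B) :
    IsCompleteContraction f.toLinear := fun _ M => matrixNorm_map_le f M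

/-- Complete contractivity can be tested in a faithful representation of the target. -/
theorem of_comp_injective (f : B →⋆ₙₐ[ℂ] C) (hf : Function.Injective f) {φ : A →ₗ[ℂ] B}
    (h : IsCompleteContraction (f.toLinear ∘ₗ φ)) : IsCompleteContraction φ := fun k M => by
  rw [← matrixNorm_map_eq f hf]
  exact h k M

theorem norm_le {φ : A →ₗ[ℂ] B} (hφ : IsCompleteContraction φ) (a : A) : ‖φ a‖ ≤ ‖a‖ := by
  rw [← matrixNorm_oneByOne, ← matrixNorm_oneByOne a]
  exact hφ 1 (CStarMatrix.ofMatrix fun _ _ => a)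

theorem prod {φ : A →ₗ[ℂ] B} {ψ : A →ₗ[ℂ] C} (hφ : IsCompleteContraction φ)
    (hψ : IsCompleteContraction ψ) : IsCompleteContraction (φ.prod ψ) := by
  intro k M
  let _ := CStarAlgebra.spectralOrder B
  have _ := CStarAlgebra.spectralOrderedRing B
  let _ := CStarAlgebra.spectralOrder C
  have _ := CStarAlgebra.spectralOrderedRing C
  -- Matrices over a product embed in the product of the matrix algebras, whose norm is the maximum.
  let F : CStarMatrix (Fin k) (Fin k) (B × C) →⋆ₙₐ[ℂ]
      CStarMatrix (Fin k) (Fin k) B × CStarMatrix (Fin k) (Fin k) C :=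
    (CStarMatrix.mapₙₐ (NonUnitalStarAlgHom.fst ℂ B C)).prod
      (CStarMatrix.mapₙₐ (NonUnitalStarAlgHom.snd ℂ B C))
  have hF : Function.Injective F := by
    intro M N h
    ext i j
    · exact congrFun (congrFun (congrArg Prod.fst h) i) j
    · exact congrFun (congrFun (congrArg Prod.snd h) i) j
  rw [← norm_apply_eq_matrixNorm F hF]
  exact max_le (hφ k M) (hψ k M)

/-- Compressions `x ↦ V x W` with contractions `V` and `W`. -/
theorem compression {V : H →L[ℂ] K} {W : K →L[ℂ] H} (hV : ‖V‖ ≤ 1) (hW : ‖W‖ ≤ 1)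
    {φ : A →ₗ[ℂ] (H →L[ℂ] H)} (hφ : IsCompleteContraction φ) {ψ : A →ₗ[ℂ] (K →L[ℂ] K)}
    (h : ∀ a, ψ a = V ∘L φ a ∘L W) : IsCompleteContraction ψ := by
  intro k M
  refine le_trans ?_ (hφ k M)
  rw [← norm_toOperator (H := K), ← norm_toOperator (H := H)]
  refine ContinuousLinearMap.opNorm_le_bound _ (norm_nonneg _) fun x => ?_
  -- The amplification of a compression is the compression by the diagonal operators built from `V`
  -- and `W`, which are again contractions.
  have e : CStarMatrix.toOperator k K (M.map ψ) x = WithLp.toLp 2 fun i =>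
      V (CStarMatrix.toOperator k H (M.map φ) (WithLp.toLp 2 fun i => W (x i)) i) := by
    ext i
    simp [CStarMatrix.toOperator_apply, h]
  rw [e]
  refine (norm_toLp_map_le hV _).trans ?_
  exact (ContinuousLinearMap.le_opNorm _ _).trans
    (mul_le_mul_of_nonneg_left (norm_toLp_map_le hW x) (norm_nonneg _))

end IsCompleteContraction

end MatrixNorm

/-! ### Extending representations of a unital subalgebra to complete contractions. -/

section Extension

variable {B D : Type*} [CStarAlgebra B] [CStarAlgebra D]
  {K : Type*} [NormedAddCommGroup K] [InnerProductSpace ℂ K] [CompleteSpace K]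

/-- A bounded functional that attains its norm bound at `1` has nonnegative real part on positive
elements. -/
theorem re_nonneg_of_norm_le_apply_one [PartialOrder D] [StarOrderedRing D]
    (g : StrongDual ℂ D) {r : ℝ} (hg : ‖g‖ ≤ r) (h1 : g 1 = r) {x : D} (hx : 0 ≤ x) :
    0 ≤ (g x).re := by
  have hxs : IsSelfAdjoint x := .of_nonneg hx
  have hle : x ≤ algebraMap ℝ D ‖x‖ := hxs.le_algebraMap_norm_self
  -- As `0 ≤ x ≤ ‖x‖`, also `‖‖x‖ - x‖ ≤ ‖x‖`; hence `g x` lies in the disc of radius `r ‖x‖` around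
  -- `r ‖x‖`.
  have hn : ‖algebraMap ℝ D ‖x‖ - x‖ ≤ ‖x‖ := by
    rcases subsingleton_or_nontrivial D with h | h
    · rw [Subsingleton.elim (algebraMap ℝ D ‖x‖ - x) 0]; simp
    · refine (CStarAlgebra.norm_le_norm_of_nonneg_of_le (sub_nonneg.2 hle)
        (sub_le_self _ hx)).trans ?_
      rw [norm_algebraMap', norm_norm]
  have h2 : ‖g (algebraMap ℝ D ‖x‖ - x)‖ ≤ r * ‖x‖ :=
    (g.le_of_opNorm_le hg _).trans
      (mul_le_mul_of_nonneg_left hn ((norm_nonneg g).trans hg))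
  have h3 : g (algebraMap ℝ D ‖x‖ - x) = (‖x‖ : ℂ) * r - g x := by
    rw [map_sub, Algebra.algebraMap_eq_smul_one, ← Complex.coe_smul, map_smul, h1, smul_eq_mul]
  rw [h3] at h2
  have h4 := (Complex.re_le_norm _).trans h2
  rw [Complex.sub_re, ← Complex.ofReal_mul, Complex.ofReal_re] at h4
  linarith [mul_comm r ‖x‖]

theorem exists_positive_extension [PartialOrder D] [StarOrderedRing D]
    (ι : B →⋆ₐ[ℂ] D) (hι : Function.Injective ι) (ρ : B →⋆ₐ[ℂ] (K →L[ℂ] K)) (ξ : K) :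
    ∃ f : D →ₚ[ℂ] ℂ, ∀ b, f (ι b) = inner ℂ ξ (ρ b ξ) := by
  let e : B ≃ₗ[ℂ] LinearMap.range (ι : B →ₗ[ℂ] D) := LinearEquiv.ofInjective (ι : B →ₗ[ℂ] D) hι
  let v : B →ₗ[ℂ] ℂ :=
    { toFun b := inner ℂ ξ (ρ b ξ)
      map_add' a b := by simp
      map_smul' c a := by simp }
  have hv : ∀ b, ‖v b‖ ≤ ‖ξ‖ ^ 2 * ‖ι b‖ := by
    intro b
    rw [NonUnitalStarAlgHom.norm_map ι hι]
    calc ‖v b‖ ≤ ‖ξ‖ * ‖ρ b ξ‖ := norm_inner_le_norm _ _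
      _ ≤ ‖ξ‖ * (‖b‖ * ‖ξ‖) := by
        gcongr
        exact (ρ b).le_of_opNorm_le (NonUnitalStarAlgHom.norm_apply_le ρ b) ξ
      _ = ‖ξ‖ ^ 2 * ‖b‖ := by ring
  let g₀ : StrongDual ℂ (LinearMap.range (ι : B →ₗ[ℂ] D)) :=
    (v ∘ₗ e.symm.toLinearMap).mkContinuous (‖ξ‖ ^ 2) fun x => by
      obtain ⟨b, rfl⟩ := e.surjective x
      have : e.symm (e b) = b := e.symm_apply_apply b
      simp only [LinearMap.coe_comp, LinearEquiv.coe_coe, Function.comp_apply, this]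
      exact hv b
  obtain ⟨g, hg, hgn⟩ := exists_extension_norm_eq _ g₀
  have hgι : ∀ b, g (ι b) = inner ℂ ξ (ρ b ξ) := by
    intro b
    have h : g₀ (e b) = v b := congrArg v (e.symm_apply_apply b)
    exact (hg (e b)).trans h
  have hgr : ‖g‖ ≤ ‖ξ‖ ^ 2 := hgn ▸ LinearMap.mkContinuous_norm_le _ (by positivity) _
  have hg1 : g 1 = ((‖ξ‖ ^ 2 : ℝ) : ℂ) := by
    have := hgι 1
    rw [map_one ι, map_one ρ] at this
    rw [this]
    simp
  -- The hermitian part of `g`: real on positive elements, and equal to `g` on the image of `B`,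
  -- where `g` is already hermitian.
  let f : D →ₗ[ℂ] ℂ :=
    { toFun x := (g x + star (g (star x))) / 2
      map_add' x y := by simp only [map_add, star_add]; ring
      map_smul' c x := by
        simp only [map_smul, star_smul, smul_eq_mul, star_mul', star_star, RingHom.id_apply]; ring }
  refine ⟨PositiveLinearMap.mk₀ f fun x hx => ?_, fun b => ?_⟩
  · have hs : star x = x := (IsSelfAdjoint.of_nonneg hx).star_eq
    have : f x = ((g x).re : ℂ) := by
      change (g x + star (g (star x))) / 2 = _
      rw [hs, Complex.re_eq_add_conj]
      rfl
    rw [this]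
    exact_mod_cast re_nonneg_of_norm_le_apply_one g hgr hg1 hx
  · change (g (ι b) + star (g (star (ι b)))) / 2 = _
    rw [← map_star ι, hgι, hgι, map_star, ContinuousLinearMap.star_eq_adjoint,
      ContinuousLinearMap.adjoint_inner_right]
    have : star (inner ℂ (ρ b ξ) ξ) = inner ℂ ξ (ρ b ξ) := inner_conj_symm _ _
    rw [this]; ring

theorem PositiveLinearMap.gns_inner [PartialOrder D] [StarOrderedRing D] (f : D →ₚ[ℂ] ℂ)
    (a b : D) :
    inner ℂ (f.gnsStarAlgHom a (f.toPreGNS 1 : f.GNS)) (f.gnsStarAlgHom b (f.toPreGNS 1 : f.GNS)) =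
      f (star a * b) := by
  simp [PositiveLinearMap.preGNS_inner_def]

/-- The Hilbert sum of a family of representations. -/
def lp.hilbertSumHom {ι : Type*} {G : ι → Type*} [∀ i, NormedAddCommGroup (G i)]
    [∀ i, InnerProductSpace ℂ (G i)] [∀ i, CompleteSpace (G i)]
    (τ : ∀ i, D →⋆ₐ[ℂ] (G i →L[ℂ] G i)) : D →⋆ₙₐ[ℂ] (lp G 2 →L[ℂ] lp G 2) where
  toFun d := lp.mapCLM 2 (fun i => τ i d) (norm_nonneg d)
    fun i => NonUnitalStarAlgHom.norm_apply_le (τ i) d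
  map_smul' c d := by ext x i; simp
  map_zero' := by ext x i; simp
  map_add' c d := by ext x i; simp
  map_mul' c d := by ext x i; simp
  map_star' d := by
    rw [ContinuousLinearMap.star_eq_adjoint, ContinuousLinearMap.eq_adjoint_iff]
    intro x y
    rw [lp.inner_eq_tsum, lp.inner_eq_tsum]
    refine tsum_congr fun i => ?_
    simp only [lp.mapCLM_apply_coe]
    rw [map_star, ContinuousLinearMap.star_eq_adjoint, ContinuousLinearMap.adjoint_inner_left]

theorem exists_orthogonal_cyclic_family (ρ : B →⋆ₐ[ℂ] (K →L[ℂ] K)) :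
    ∃ S : Set K, (∀ ξ ∈ S, ∀ η ∈ S, ξ ≠ η → ∀ b, inner ℂ (ρ b ξ) η = 0) ∧
      ∀ v, (∀ ξ ∈ S, ∀ b, inner ℂ (ρ b ξ) v = 0) → v = 0 := by
  obtain ⟨S, hS⟩ := zorn_subset
    {S : Set K | ∀ ξ ∈ S, ∀ η ∈ S, ξ ≠ η → ∀ b, inner ℂ (ρ b ξ) η = 0} (by
      intro c hc hchain
      refine ⟨⋃₀ c, ?_, fun s hs => Set.subset_sUnion_of_mem hs⟩
      rintro ξ ⟨s, hs, hξ⟩ η ⟨t, ht, hη⟩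
      rcases hchain.total hs ht with h | h
      · exact hc ht ξ (h hξ) η hη
      · exact hc hs ξ hξ η (h hη))
  refine ⟨S, hS.prop, fun v hv => ?_⟩
  -- By maximality `v` itself belongs to `S`; since `ρ 1 = 1`, it is then orthogonal to itself.
  have hmem : v ∈ S := by
    refine hS.le_of_ge (y := insert v S) ?_ (Set.subset_insert _ _) (Set.mem_insert v S)
    rintro ξ (rfl | hξ) η (rfl | hη) hne b
    · exact absurd rfl hne
    · rw [← ContinuousLinearMap.adjoint_inner_right, ← ContinuousLinearMap.star_eq_adjoint,
        ← map_star, ← inner_conj_symm, hv η hη, map_zero]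
    · exact hv ξ hξ b
    · exact hS.prop ξ hξ η hη hne b
  simpa using hv v hmem 1

open Classical in
/-- A representation of a unital subalgebra `B` of a C⋆-algebra `D` extends to a complete
contraction on `D`. -/
theorem exists_completeContraction_extension (ι : B →⋆ₐ[ℂ] D) (hι : Function.Injective ι)
    (ρ : B →⋆ₐ[ℂ] (K →L[ℂ] K)) :
    ∃ Θ : D →ₗ[ℂ] (K →L[ℂ] K), IsCompleteContraction Θ ∧ ∀ b, Θ (ι b) = ρ b := by
  let _ := CStarAlgebra.spectralOrder D
  have _ := CStarAlgebra.spectralOrderedRing D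
  choose f hf using exists_positive_extension ι hι ρ
  obtain ⟨S, hS, hdense⟩ := exists_orthogonal_cyclic_family ρ
  let τ := lp.hilbertSumHom (D := D) (fun ξ : S => (f ξ).gnsStarAlgHom)
  let F : (S →₀ B) →ₗ[ℂ] K := Finsupp.lsum ℂ fun ξ =>
    { toFun b := ρ b ξ
      map_add' a b := by simp
      map_smul' c b := by simp }
  let E : (S →₀ B) →ₗ[ℂ] lp (fun ξ : S => (f ξ).GNS) 2 := Finsupp.lsum ℂ fun ξ =>
    { toFun b := lp.single 2 ξ ((f ξ).gnsStarAlgHom (ι b) ((f ξ).toPreGNS 1 : (f ξ).GNS))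
      map_add' a b := by simp only [map_add, add_apply, lp.single_add]
      map_smul' c b := by
        simp only [map_smul, smul_apply, lp.single_smul, RingHom.id_apply] }
  have hFs : ∀ ξ b, F (Finsupp.single ξ b) = ρ b ξ := fun ξ b => by simp [F]
  have hEs : ∀ ξ b, E (Finsupp.single ξ b) =
      lp.single 2 ξ ((f ξ).gnsStarAlgHom (ι b) ((f ξ).toPreGNS 1 : (f ξ).GNS)) :=
    fun ξ b => by simp only [E, Finsupp.lsum_single]; rfl
  -- Formal sums have the same Gram form in `K` and in the sum of the GNS spaces: equal indices
  -- agree by the choice of `f ξ`, distinct ones are orthogonal on both sides. So `F x ↦ E x`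
  -- extends to the isometry `V` below.
  have hinner : ∀ x y, inner ℂ (E x) (E y) = inner ℂ (F x) (F y) := by
    intro x y
    induction x using Finsupp.induction_linear with
    | zero => simp
    | add x₁ x₂ h₁ h₂ => simp only [map_add, inner_add_left, h₁, h₂]
    | single ξ a =>
      induction y using Finsupp.induction_linear with
      | zero => simp
      | add y₁ y₂ h₁ h₂ => simp only [map_add, inner_add_right, h₁, h₂]
      | single η b =>
        rw [hFs, hFs, hEs, hEs, lp.inner_single_left, lp.single_apply]
        by_cases h : ξ = η
        · subst h
          rw [Pi.single_eq_same, PositiveLinearMap.gns_inner, ← map_star, ← map_mul, hf, map_mul,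
            map_star, ContinuousLinearMap.star_eq_adjoint, mul_apply_eq_comp,
            ContinuousLinearMap.adjoint_inner_right]
        · rw [Pi.single_eq_of_ne h, inner_zero_right, ← ContinuousLinearMap.adjoint_inner_left,
            ← ContinuousLinearMap.star_eq_adjoint, ← map_star, ← mul_apply_eq_comp,
            ← map_mul]
          exact (hS ξ ξ.2 η η.2 (fun h' => h (Subtype.ext h')) _).symm
  have hnorm : ∀ x, ‖E x‖ = ‖F x‖ := by
    intro x
    rw [@norm_eq_sqrt_re_inner ℂ, @norm_eq_sqrt_re_inner ℂ, hinner]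
  have hF : DenseRange F := by
    have : (LinearMap.range F)ᗮ = ⊥ := by
      rw [Submodule.eq_bot_iff]
      intro v hv
      refine hdense v fun ξ hξ b => ?_
      rw [Submodule.mem_orthogonal] at hv
      exact hv _ ⟨Finsupp.single ⟨ξ, hξ⟩ b, hFs _ _⟩
    rw [DenseRange, ← LinearMap.coe_range]
    exact Submodule.dense_iff_topologicalClosure_eq_top.2
      ((Submodule.topologicalClosure_eq_top_iff).2 this)
  let V : K →L[ℂ] lp (fun ξ : S => (f ξ).GNS) 2 := E.extendOfNorm F
  have hV : ∀ x, V (F x) = E x :=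
    LinearMap.extendOfNorm_eq hF ⟨1, fun x => by rw [one_mul, hnorm]⟩
  have hVn : ‖V‖ ≤ 1 :=
    LinearMap.opNorm_extendOfNorm_le hF zero_le_one fun x => by rw [one_mul, hnorm]
  -- Left multiplication by `b` on formal sums; through it `V` intertwines `ρ b` with `τ (ι b)`.
  let m : B → (S →₀ B) → (S →₀ B) := fun b x => x.mapRange (b * ·) (mul_zero b)
  have hm : ∀ b x, F (m b x) = ρ b (F x) ∧ E (m b x) = τ (ι b) (E x) := by
    intro b x
    induction x using Finsupp.induction_linear with
    | zero => simp [m]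
    | add x y hx hy =>
      have : m b (x + y) = m b x + m b y := Finsupp.mapRange_add (mul_add b) x y
      simp only [this, map_add, hx, hy, and_self]
    | single ξ a =>
      have : m b (Finsupp.single ξ a) = Finsupp.single ξ (b * a) := Finsupp.mapRange_single
      rw [this, hFs, hFs, hEs, hEs]
      refine ⟨by simp, ?_⟩
      ext η
      by_cases h : ξ = η
      · subst h
        simp [τ, lp.hilbertSumHom]
      · simp [τ, lp.hilbertSumHom, h]
  let Θ : D →ₗ[ℂ] (K →L[ℂ] K) :=
    { toFun d := V.adjoint ∘L τ d ∘L V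
      map_add' a b := by ext; simp
      map_smul' c a := by ext; simp }
  refine ⟨Θ, IsCompleteContraction.compression
    (by rwa [LinearIsometryEquiv.norm_map]) hVn (IsCompleteContraction.of_starHom τ)
    (fun d => rfl), fun b => ?_⟩
  have key : ∀ x y, inner ℂ (F x) (Θ (ι b) (F y)) = inner ℂ (F x) (ρ b (F y)) := by
    intro x y
    change inner ℂ (F x) (V.adjoint (τ (ι b) (V (F y)))) = _
    rw [ContinuousLinearMap.adjoint_inner_right, hV, hV, ← (hm b y).2, ← (hm b y).1, hinner]
  have h2 : ∀ y, Θ (ι b) (F y) = ρ b (F y) := by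
    intro y
    refine ext_inner_left ℂ fun v => ?_
    exact congrFun (hF.equalizer (g := fun v => inner ℂ v (Θ (ι b) (F y)))
      (h := fun v => inner ℂ v (ρ b (F y))) (by fun_prop) (by fun_prop)
      (funext fun x => key x y)) v
  exact ContinuousLinearMap.ext fun v => congrFun (hF.equalizer (by fun_prop) (by fun_prop)
    (funext h2)) v

end Extension

/-! ### Faithful unital extensions and compression into `A`. -/

section Unitization

variable {A : Type*} [NonUnitalCStarAlgebra A]
  {H : Type*} [NormedAddCommGroup H] [InnerProductSpace ℂ H] [CompleteSpace H]
  {K : Type*} [NormedAddCommGroup K] [InnerProductSpace ℂ K] [CompleteSpace K]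

theorem Unitization.starLift_apply' (π : A →⋆ₙₐ[ℂ] (H →L[ℂ] H)) (b : Unitization ℂ A) :
    Unitization.starLift π b = b.fst • (1 : H →L[ℂ] H) + π b.snd := by
  rw [← Algebra.algebraMap_eq_smul_one]
  rfl

theorem Unitization.starLift_injective
    (hA : ¬ ∃ e : A, ∀ a : A, e * a = a ∧ a * e = a)
    {π : A →⋆ₙₐ[ℂ] (H →L[ℂ] H)} (hπ : Function.Injective π) :
    Function.Injective (Unitization.starLift π) := by
  rw [injective_iff_map_eq_zero]
  intro b hb
  rw [Unitization.starLift_apply'] at hb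
  by_cases h : b.fst = 0
  · rw [h, zero_smul, zero_add] at hb
    exact Unitization.ext h (hπ (by rw [hb, Unitization.snd_zero, map_zero]))
  -- If `z + a` with `z ≠ 0` acts as zero, then `-z⁻¹ a` is a unit for `A`.
  · refine absurd ⟨-(b.fst)⁻¹ • b.snd, fun a => ⟨hπ ?_, hπ ?_⟩⟩ hA
    all_goals
      rw [map_mul, map_smul, eq_neg_of_add_eq_zero_right hb]
      simp [smul_smul, h]

/-- If `A` has no unit, any representation `ρ` of `A` factors through a faithful one by a complete
contraction. -/
theorem exists_completeContraction_comp_eq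
    (hA : ¬ ∃ e : A, ∀ a : A, e * a = a ∧ a * e = a)
    {π : A →⋆ₙₐ[ℂ] (H →L[ℂ] H)} (hπ : Function.Injective π) (ρ : A →⋆ₙₐ[ℂ] (K →L[ℂ] K)) :
    ∃ Θ : (H →L[ℂ] H) →ₗ[ℂ] (K →L[ℂ] K), IsCompleteContraction Θ ∧ ∀ a, Θ (π a) = ρ a := by
  obtain ⟨Θ, hΘ, h⟩ := exists_completeContraction_extension (Unitization.starLift π)
    (Unitization.starLift_injective hA hπ) (Unitization.starLift ρ)
  refine ⟨Θ, hΘ, fun a => ?_⟩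
  have := h (Unitization.inr a)
  rw [Unitization.starLift_apply', Unitization.starLift_apply'] at this
  simpa using this

/-- The two-sided compression `b ↦ f b f`, which maps the unitization into the ideal `A`. -/
def Unitization.compress (f : A) : Unitization ℂ A →ₗ[ℂ] A where
  toFun b := b.fst • (f * f) + f * b.snd * f
  map_add' a b := by
    simp only [Unitization.fst_add, Unitization.snd_add, add_smul, mul_add, add_mul]; abel
  map_smul' c a := by
    simp [mul_smul, mul_smul_comm, smul_mul_assoc]

theorem isCompleteContraction_compress {π : A →⋆ₙₐ[ℂ] (H →L[ℂ] H)} (hπ : Function.Injective π)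
    {f : A} (hf : ‖f‖ ≤ 1) : IsCompleteContraction (Unitization.compress f) := by
  refine IsCompleteContraction.of_comp_injective π hπ ?_
  have hf' : ‖π f‖ ≤ 1 := (NonUnitalStarAlgHom.norm_apply_le π f).trans hf
  refine IsCompleteContraction.compression hf' hf'
    (IsCompleteContraction.of_starHom
      (Unitization.starLift π : Unitization ℂ A →⋆ₙₐ[ℂ] (H →L[ℂ] H))) fun b => ?_
  change π (b.fst • (f * f) + f * b.snd * f) = π f ∘L Unitization.starLift π b ∘L π f
  rw [Unitization.starLift_apply']
  ext v
  simp

end Unitization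

/-! ### Block-diagonal operators and corners. -/

section DirectSum

variable {A : Type*} [NonUnitalCStarAlgebra A]
  {H : Type*} [NormedAddCommGroup H] [InnerProductSpace ℂ H] [CompleteSpace H]
  {K : Type*} [NormedAddCommGroup K] [InnerProductSpace ℂ K] [CompleteSpace K]

/-- Pairs of operators, acting diagonally on the direct sum of Hilbert spaces. -/
def blockDiag (H K : Type*) [NormedAddCommGroup H] [InnerProductSpace ℂ H] [CompleteSpace H]
    [NormedAddCommGroup K] [InnerProductSpace ℂ K] [CompleteSpace K] :
    (H →L[ℂ] H) × (K →L[ℂ] K) →⋆ₙₐ[ℂ] (WithLp 2 (H × K) →L[ℂ] WithLp 2 (H × K)) where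
  toFun T := (WithLp.prodContinuousLinearEquiv 2 ℂ H K).symm.toContinuousLinearMap ∘L
    (T.1.prodMap T.2) ∘L (WithLp.prodContinuousLinearEquiv 2 ℂ H K).toContinuousLinearMap
  map_smul' _ _ := rfl
  map_zero' := rfl
  map_add' _ _ := rfl
  map_mul' _ _ := rfl
  map_star' T := by
    rw [ContinuousLinearMap.star_eq_adjoint, ContinuousLinearMap.eq_adjoint_iff]
    intro x y
    simp [WithLp.prod_inner_apply, ContinuousLinearMap.star_eq_adjoint,
      ContinuousLinearMap.adjoint_inner_left]

theorem blockDiag_apply (T : (H →L[ℂ] H) × (K →L[ℂ] K)) (x : WithLp 2 (H × K)) :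
    blockDiag H K T x = WithLp.toLp 2 (T.1 x.fst, T.2 x.snd) := rfl

theorem IsCompleteContraction.blockDiag {φ : A →ₗ[ℂ] (H →L[ℂ] H)} {ψ : A →ₗ[ℂ] (K →L[ℂ] K)}
    (hφ : IsCompleteContraction φ) (hψ : IsCompleteContraction ψ) :
    IsCompleteContraction
      ((_root_.blockDiag H K).toLinear ∘ₗ φ.prod ψ) :=
  (IsCompleteContraction.of_starHom (_root_.blockDiag H K)).comp (hφ.prod hψ)

/-- The first corner of an operator on a direct sum. -/
def cornerFst (H K : Type*) [NormedAddCommGroup H] [InnerProductSpace ℂ H]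
    [NormedAddCommGroup K] [InnerProductSpace ℂ K] :
    (WithLp 2 (H × K) →L[ℂ] WithLp 2 (H × K)) →ₗ[ℂ] (H →L[ℂ] H) where
  toFun X := WithLp.fstL 2 ℂ H K ∘L X ∘L
    (WithLp.prodContinuousLinearEquiv 2 ℂ H K).symm.toContinuousLinearMap ∘L
      ContinuousLinearMap.inl ℂ H K
  map_add' _ _ := rfl
  map_smul' _ _ := rfl

/-- The second corner of an operator on a direct sum. -/
def cornerSnd (H K : Type*) [NormedAddCommGroup H] [InnerProductSpace ℂ H]
    [NormedAddCommGroup K] [InnerProductSpace ℂ K] :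
    (WithLp 2 (H × K) →L[ℂ] WithLp 2 (H × K)) →ₗ[ℂ] (K →L[ℂ] K) where
  toFun X := WithLp.sndL 2 ℂ H K ∘L X ∘L
    (WithLp.prodContinuousLinearEquiv 2 ℂ H K).symm.toContinuousLinearMap ∘L
      ContinuousLinearMap.inr ℂ H K
  map_add' _ _ := rfl
  map_smul' _ _ := rfl

theorem isCompleteContraction_cornerFst : IsCompleteContraction (cornerFst H K) := by
  refine IsCompleteContraction.compression
    (A := WithLp 2 (H × K) →L[ℂ] WithLp 2 (H × K)) (φ := LinearMap.id)
    (V := WithLp.fstL 2 ℂ H K)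
    (W := (WithLp.prodContinuousLinearEquiv 2 ℂ H K).symm.toContinuousLinearMap ∘L
      ContinuousLinearMap.inl ℂ H K) ?_ ?_ (fun k M => le_rfl) (fun X => rfl)
  · refine ContinuousLinearMap.opNorm_le_bound _ zero_le_one fun x => ?_
    rw [one_mul]
    exact WithLp.norm_fst_le H x
  · refine ContinuousLinearMap.opNorm_le_bound _ zero_le_one fun x => ?_
    simp

theorem isCompleteContraction_cornerSnd : IsCompleteContraction (cornerSnd H K) := by
  refine IsCompleteContraction.compression
    (A := WithLp 2 (H × K) →L[ℂ] WithLp 2 (H × K)) (φ := LinearMap.id)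
    (V := WithLp.sndL 2 ℂ H K)
    (W := (WithLp.prodContinuousLinearEquiv 2 ℂ H K).symm.toContinuousLinearMap ∘L
      ContinuousLinearMap.inr ℂ H K) ?_ ?_ (fun k M => le_rfl) (fun X => rfl)
  · refine ContinuousLinearMap.opNorm_le_bound _ zero_le_one fun x => ?_
    rw [one_mul]
    exact WithLp.norm_snd_le H x
  · refine ContinuousLinearMap.opNorm_le_bound _ zero_le_one fun x => ?_
    simp

/-- Operators on the line, as multiples of the identity on `H`. -/
def scalarHom (H : Type*) [NormedAddCommGroup H] [InnerProductSpace ℂ H] [CompleteSpace H] :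
    (ℂ →L[ℂ] ℂ) →⋆ₙₐ[ℂ] (H →L[ℂ] H) where
  toFun X := X 1 • 1
  map_smul' c X := by simp [smul_smul]
  map_zero' := by simp
  map_add' X Y := by simp [add_smul]
  map_mul' X Y := by
    have : X (Y 1) = Y 1 * X 1 := by
      conv_lhs => rw [← mul_one (Y 1), ← smul_eq_mul, map_smul, smul_eq_mul]
    simp [this, smul_smul, mul_comm]
  map_star' X := by
    have : (star X) 1 = star (X 1) := by
      have h := ContinuousLinearMap.adjoint_inner_left X (1 : ℂ) (1 : ℂ)
      have h' := congrArg star h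
      simpa [ContinuousLinearMap.star_eq_adjoint] using h'
    rw [this, star_smul, star_one]

end DirectSum

/-! ### Factorizations through matrix algebras. -/

section Rank

variable {A : Type*} [NonUnitalCStarAlgebra A]
  {H : Type*} [NormedAddCommGroup H] [InnerProductSpace ℂ H] [CompleteSpace H]
  {K : Type*} [NormedAddCommGroup K] [InnerProductSpace ℂ K] [CompleteSpace K]

/-- Operators on a finite-dimensional Hilbert space, as matrices. -/
def operatorEquivMatrix (E : Type*) [NormedAddCommGroup E] [InnerProductSpace ℂ E]
    [FiniteDimensional ℂ E] [CompleteSpace E] :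
    (E →L[ℂ] E) ≃⋆ₐ[ℂ]
      CStarMatrix (Fin (Module.finrank ℂ E)) (Fin (Module.finrank ℂ E)) ℂ :=
  ((stdOrthonormalBasis ℂ E).repr.conjStarAlgEquiv.trans
    (Matrix.toEuclideanCLM (𝕜 := ℂ)).symm).trans CStarMatrix.ofMatrixStarAlgEquiv

/-- An orthonormal basis identifies operators on `E` with matrices, so one may factor through spaces
such as `ℂᵐ ⊕ ℂ` without indices. -/
theorem rcc_le_finrank {E : Type*} [NormedAddCommGroup E] [InnerProductSpace ℂ E]
    [FiniteDimensional ℂ E] [CompleteSpace E] [Nontrivial E]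
    {π : A →⋆ₙₐ[ℂ] (H →L[ℂ] H)} {S : Set A} {δ : ℝ}
    {φ : A →ₗ[ℂ] (E →L[ℂ] E)} {ψ : (E →L[ℂ] E) →ₗ[ℂ] (H →L[ℂ] H)}
    (hφ : IsCompleteContraction φ) (hψ : IsCompleteContraction ψ)
    (h : ∀ a ∈ S, ‖ψ (φ a) - π a‖ < δ) : rcc π S δ ≤ (Module.finrank ℂ E : ℕ∞) := by
  let u := operatorEquivMatrix E
  let u₁ := u.toNonUnitalStarAlgHom
  let u₂ := u.symm.toNonUnitalStarAlgHom
  refine sInf_le ⟨Module.finrank ℂ E, Module.finrank_pos, rfl,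
    u₁.toLinear ∘ₗ φ,
    ψ ∘ₗ u₂.toLinear,
    ?_, ?_, ?_⟩
  · exact (IsCompleteContraction.of_starHom u₁).comp hφ
  · exact hψ.comp (IsCompleteContraction.of_starHom u₂)
  · intro a ha
    have : u.symm (u (φ a)) = φ a := u.symm_apply_apply _
    change ‖ψ (u.symm (u (φ a))) - π a‖ < δ
    rw [this]
    exact h a ha

theorem exists_factorization_of_rcc_ne_top {π : A →⋆ₙₐ[ℂ] (H →L[ℂ] H)} {S : Set A} {δ : ℝ}
    (h : rcc π S δ ≠ ⊤) :
    ∃ m : ℕ, 1 ≤ m ∧ rcc π S δ = m ∧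
      ∃ (φ : A →ₗ[ℂ] CStarMatrix (Fin m) (Fin m) ℂ)
        (ψ : CStarMatrix (Fin m) (Fin m) ℂ →ₗ[ℂ] (H →L[ℂ] H)),
        IsCompleteContraction φ ∧ IsCompleteContraction ψ ∧ ∀ a ∈ S, ‖ψ (φ a) - π a‖ < δ := by
  refine csInf_mem (s := {r : ℕ∞ | ∃ m : ℕ, 1 ≤ m ∧ r = (m : ℕ∞) ∧
    ∃ (φ : A →ₗ[ℂ] CStarMatrix (Fin m) (Fin m) ℂ)
      (ψ : CStarMatrix (Fin m) (Fin m) ℂ →ₗ[ℂ] (H →L[ℂ] H)),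
      IsCompleteContraction φ ∧ IsCompleteContraction ψ ∧ ∀ a ∈ S, ‖ψ (φ a) - π a‖ < δ}) ?_
  by_contra hne
  rw [Set.not_nonempty_iff_eq_empty] at hne
  exact h (by rw [rcc, hne, sInf_empty])

/-- The rank drops along a pair of complete contractions between algebras and operator spaces. -/
theorem rcc_le_rcc {B : Type*} [NonUnitalCStarAlgebra B] {π : A →⋆ₙₐ[ℂ] (H →L[ℂ] H)}
    {ρ : B →⋆ₙₐ[ℂ] (K →L[ℂ] K)} {S : Set A} {T : Set B} {δ : ℝ}
    {ι : B →ₗ[ℂ] A} (hι : IsCompleteContraction ι)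
    {Θ : (H →L[ℂ] H) →ₗ[ℂ] (K →L[ℂ] K)} (hΘ : IsCompleteContraction Θ)
    (hS : ∀ b ∈ T, ι b ∈ S) (h : ∀ b ∈ T, Θ (π (ι b)) = ρ b) : rcc ρ T δ ≤ rcc π S δ := by
  refine le_sInf ?_
  rintro _ ⟨m, hm, rfl, φ, ψ, hφ, hψ, hδ⟩
  refine sInf_le ⟨m, hm, rfl, φ ∘ₗ ι, Θ ∘ₗ ψ, hφ.comp hι, hΘ.comp hψ, fun b hb => ?_⟩
  rw [← h b hb]
  change ‖Θ (ψ (φ (ι b))) - _‖ < δ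
  rw [← map_sub]
  exact (hΘ.norm_le _).trans_lt (hδ _ (hS b hb))

/-- Complete contractions on `A`, cut down by `f` and completed by the character of the
unitization, give a factorization for the unitization. -/
theorem rcc_unitization_le {π : A →⋆ₙₐ[ℂ] (H →L[ℂ] H)} (hπ : Function.Injective π)
    {ρ : Unitization ℂ A →⋆ₙₐ[ℂ] (H →L[ℂ] H)} {S : Set (Unitization ℂ A)} {δ : ℝ} {m : ℕ}
    {φ : A →ₗ[ℂ] CStarMatrix (Fin m) (Fin m) ℂ}
    {ψ : CStarMatrix (Fin m) (Fin m) ℂ →ₗ[ℂ] (H →L[ℂ] H)}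
    (hφ : IsCompleteContraction φ) (hψ : IsCompleteContraction ψ)
    {f : A} (hf : ‖f‖ ≤ 1) {c l k : H →L[ℂ] H} (hc : ‖c‖ ≤ 1)
    (hlk : star l * l + star k * k = 1)
    (h : ∀ b ∈ S, ‖star l * (c * ψ (φ (Unitization.compress f b))) * l + b.fst • (star k * k)
      - ρ b‖ < δ) :
    rcc ρ S δ ≤ (m + 1 : ℕ) := by
  let E := EuclideanSpace ℂ (Fin m)
  let u : CStarMatrix (Fin m) (Fin m) ℂ ≃⋆ₐ[ℂ] (E →L[ℂ] E) :=
    CStarMatrix.ofMatrixStarAlgEquiv.symm.trans (Matrix.toEuclideanCLM (𝕜 := ℂ))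
  let u₁ := u.toNonUnitalStarAlgHom
  let u₂ := u.symm.toNonUnitalStarAlgHom
  let φ₁ : Unitization ℂ A →ₗ[ℂ] (E →L[ℂ] E) :=
    u₁.toLinear ∘ₗ φ ∘ₗ Unitization.compress f
  have hφ₁ : IsCompleteContraction φ₁ :=
    (IsCompleteContraction.of_starHom u₁).comp
      (hφ.comp (isCompleteContraction_compress hπ hf))
  let χ : Unitization ℂ A →⋆ₙₐ[ℂ] (ℂ →L[ℂ] ℂ) :=
    (Unitization.starLift (0 : A →⋆ₙₐ[ℂ] (ℂ →L[ℂ] ℂ)) : Unitization ℂ A →⋆ₐ[ℂ] _)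
  have hχ : ∀ b, χ b 1 = b.fst := fun b => by
    change Unitization.starLift (0 : A →⋆ₙₐ[ℂ] (ℂ →L[ℂ] ℂ)) b 1 = _
    rw [Unitization.starLift_apply']; simp
  let ψ₁ : (E →L[ℂ] E) →ₗ[ℂ] (H →L[ℂ] H) := LinearMap.mulLeft ℂ c ∘ₗ ψ ∘ₗ
    u₂.toLinear
  have hψ₁ : IsCompleteContraction ψ₁ := by
    refine IsCompleteContraction.compression hc
      (W := ContinuousLinearMap.id ℂ H) ContinuousLinearMap.norm_id_le
      (hψ.comp (IsCompleteContraction.of_starHom u₂)) fun X => rfl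
  -- The column with entries `l` and `k`; `hlk` says that it is an isometry.
  let V : H →L[ℂ] WithLp 2 (H × H) :=
    (WithLp.prodContinuousLinearEquiv 2 ℂ H H).symm.toContinuousLinearMap ∘L l.prod k
  have hVinner : ∀ x y : H, ∀ T : (H →L[ℂ] H) × (H →L[ℂ] H),
      inner ℂ (V x) (blockDiag H H T (V y)) =
        inner ℂ x ((star l * T.1 * l + star k * T.2 * k) y) := by
    intro x y T
    rw [blockDiag_apply, WithLp.prod_inner_apply]
    simp [V, ContinuousLinearMap.star_eq_adjoint,
      ContinuousLinearMap.adjoint_inner_right]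
  have hV : ‖V‖ ≤ 1 := by
    refine ContinuousLinearMap.opNorm_le_bound _ zero_le_one fun x => ?_
    have := hVinner x x 1
    have h1 : blockDiag H H 1 = 1 := rfl
    rw [h1] at this
    simp only [Prod.fst_one, Prod.snd_one, mul_one, hlk, one_apply_eq_self,
      inner_self_eq_norm_sq_to_K] at this
    have h2 : ‖V x‖ ^ 2 = ‖x‖ ^ 2 := by exact_mod_cast this
    rw [one_mul]
    exact (pow_le_pow_iff_left₀ (norm_nonneg _) (norm_nonneg _) two_ne_zero).1 h2.le
  let Ψ₀ : (WithLp 2 (E × ℂ) →L[ℂ] WithLp 2 (E × ℂ)) →ₗ[ℂ]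
      (WithLp 2 (H × H) →L[ℂ] WithLp 2 (H × H)) :=
    (blockDiag H H).toLinear ∘ₗ
      (ψ₁ ∘ₗ cornerFst E ℂ).prod ((scalarHom H).toLinear ∘ₗ
         cornerSnd E ℂ)
  have hΨ₀ : IsCompleteContraction Ψ₀ :=
    (hψ₁.comp (isCompleteContraction_cornerFst (K := ℂ))).blockDiag
      ((IsCompleteContraction.of_starHom (scalarHom H)).comp
        (isCompleteContraction_cornerSnd (H := E)))
  let Ψ : (WithLp 2 (E × ℂ) →L[ℂ] WithLp 2 (E × ℂ)) →ₗ[ℂ] (H →L[ℂ] H) :=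
    { toFun X := V.adjoint ∘L Ψ₀ X ∘L V
      map_add' X Y := by ext; simp
      map_smul' c X := by ext; simp }
  have hΨ : IsCompleteContraction Ψ :=
    IsCompleteContraction.compression (A := WithLp 2 (E × ℂ) →L[ℂ] WithLp 2 (E × ℂ)) (by rwa [LinearIsometryEquiv.norm_map]) hV hΨ₀ fun X => rfl
  have hdim : Module.finrank ℂ (WithLp 2 (E × ℂ)) = m + 1 := by
    rw [(WithLp.linearEquiv 2 ℂ (E × ℂ)).finrank_eq]
    simp [E]
  rw [← hdim]
  refine rcc_le_finrank (hφ₁.blockDiag (IsCompleteContraction.of_starHom χ)) hΨ fun b hb => ?_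
  convert h b hb using 3
  refine ContinuousLinearMap.ext fun y => ext_inner_left ℂ fun x => ?_
  change inner ℂ x (V.adjoint (blockDiag H H (c * ψ (u.symm (u (φ (Unitization.compress f b)))),
    (χ b 1) • 1) (V y))) = _
  rw [ContinuousLinearMap.adjoint_inner_right, hVinner, hχ, u.symm_apply_apply]
  simp [inner_add_right, inner_smul_right]

end Rank

/-! ### Norm estimates: unital completion and uniform convexity. -/

section Estimates

variable {D : Type*} [CStarAlgebra D]

/-- Each of the `n + 1` terms of the geometric sum up to `t ^ n` is at least `t ^ n`, and the sum
times `1 - t` is at most `1`. -/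
theorem mul_pow_one_sub_le (n : ℕ) {t : ℝ} (h0 : 0 ≤ t) (h1 : t ≤ 1) :
    t ^ n * (1 - t) ≤ 1 / (n + 1) := by
  rw [le_div_iff₀ (by positivity)]
  have hsum : ((n : ℝ) + 1) * t ^ n ≤ ∑ i ∈ Finset.range (n + 1), t ^ i := by
    have : ∑ _i ∈ Finset.range (n + 1), t ^ n ≤ ∑ i ∈ Finset.range (n + 1), t ^ i :=
      Finset.sum_le_sum fun i hi =>
        pow_le_pow_of_le_one h0 h1 (Nat.lt_succ_iff.1 (Finset.mem_range.1 hi))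
    simpa using this
  have hgeom := geom_sum_mul_neg t (n + 1)
  have := mul_le_mul_of_nonneg_right hsum (sub_nonneg.2 h1)
  nlinarith [pow_nonneg h0 (n + 1)]

theorem norm_pow_mul_one_sub_le [PartialOrder D] [StarOrderedRing D] {h : D} (h0 : 0 ≤ h)
    (h1 : h ≤ 1) (n : ℕ) : ‖h ^ n * (1 - h)‖ ≤ 1 / (n + 1) := by
  have hs : IsSelfAdjoint h := .of_nonneg h0
  have e : cfc (fun t : ℝ => t ^ n * (1 - t)) h = h ^ n * (1 - h) := by
    rw [cfc_mul (fun t : ℝ => t ^ n) (fun t => 1 - t) h, cfc_pow_id (R := ℝ) h n,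
      cfc_sub (fun _ : ℝ => (1 : ℝ)) (fun t => t) h, cfc_const_one ℝ h, cfc_id' ℝ h]
  rw [← e]
  refine norm_cfc_le (by positivity) fun t ht => ?_
  have ht0 : 0 ≤ t := spectrum_nonneg_of_nonneg h0 ht
  have ht1 : t ≤ 1 := by
    have := (le_algebraMap_iff_spectrum_le (a := h) (r := (1 : ℝ))).1 (by simpa using h1)
    exact this t ht
  rw [Real.norm_of_nonneg (mul_nonneg (pow_nonneg ht0 _) (sub_nonneg.2 ht1))]
  exact mul_pow_one_sub_le n ht0 ht1

theorem norm_mul_le_of_norm_le_one {a b : D} (ha : ‖a‖ ≤ 1) : ‖a * b‖ ≤ ‖b‖ :=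
  (norm_mul_le _ _).trans (mul_le_of_le_one_left (norm_nonneg _) ha)

theorem norm_mul_le_of_norm_le_one' {a b : D} (hb : ‖b‖ ≤ 1) : ‖a * b‖ ≤ ‖a‖ :=
  (norm_mul_le _ _).trans (mul_le_of_le_one_right (norm_nonneg _) hb)

theorem norm_pow_mul_sub_le {h x : D} (hh : ‖h‖ ≤ 1) {r : ℝ} (hx : ‖h * x - x‖ ≤ r) (n : ℕ) :
    ‖h ^ n * x - x‖ ≤ n * r := by
  induction n with
  | zero => simp
  | succ n ih =>
    have e : h ^ (n + 1) * x - x = h * (h ^ n * x - x) + (h * x - x) := by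
      rw [pow_succ']; noncomm_ring
    rw [e]
    refine (norm_add_le _ _).trans ?_
    have := norm_mul_le_of_norm_le_one (b := h ^ n * x - x) hh
    push_cast
    linarith

/-- An approximate left unit `c` of `x` and `x⋆` yields an approximate unital completion. -/
theorem norm_completion_sub_le {c x y k : D} {N : ℕ} {r ε : ℝ} {z : ℂ} (hc : ‖c‖ ≤ 1)
    (h₁ : ‖c * x - x‖ ≤ ε) (h₂ : ‖star c * x - x‖ ≤ ε)
    (h₃ : ‖c * star x - star x‖ ≤ ε) (h₄ : ‖star c * star x - star x‖ ≤ ε)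
    (hy : ‖y - x‖ ≤ r)
    (hk : star ((star c * c) ^ N) * (star c * c) ^ N + star k * k = 1) :
    ‖star ((star c * c) ^ N) * (star c * (z • c + y)) * (star c * c) ^ N + z • (star k * k)
      - (z • 1 + x)‖ ≤ ‖z‖ / (2 * N + 1) + r + (4 * N + 1) * ε := by
  let _ := CStarAlgebra.spectralOrder D
  have _ := CStarAlgebra.spectralOrderedRing D
  rcases subsingleton_or_nontrivial D with hD | hD
  · rw [Subsingleton.elim (_ - _) (0 : D), norm_zero]
    have := (norm_nonneg _).trans h₁
    have := (norm_nonneg _).trans hy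
    positivity
  set h := star c * c with hh
  have hcs : ‖star c‖ ≤ 1 := by rwa [norm_star]
  have h0 : 0 ≤ h := star_mul_self_nonneg c
  have hn : ‖h‖ ≤ 1 := (norm_mul_le_of_norm_le_one hcs).trans hc
  have h1 : h ≤ 1 := (CStarAlgebra.norm_le_one_iff_of_nonneg h).1 hn
  have hs : star (h ^ N) = h ^ N := by rw [star_pow, (IsSelfAdjoint.of_nonneg h0).star_eq]
  have hln : ‖h ^ N‖ ≤ 1 := (norm_pow_le h N).trans (pow_le_one₀ (norm_nonneg _) hn)
  have happ : ∀ w : D, ‖c * w - w‖ ≤ ε → ‖star c * w - w‖ ≤ ε → ‖h ^ N * w - w‖ ≤ N * (2 * ε) := by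
    intro w hw hw'
    refine norm_pow_mul_sub_le hn ?_ N
    have e : h * w - w = star c * (c * w - w) + (star c * w - w) := by rw [hh]; noncomm_ring
    rw [e]
    refine (norm_add_le _ _).trans ?_
    linarith [norm_mul_le_of_norm_le_one (b := c * w - w) hcs]
  have hlx := happ x h₁ h₂
  have hxl : ‖x * h ^ N - x‖ ≤ N * (2 * ε) := by
    rw [← norm_star, star_sub, star_mul, hs]
    exact happ _ h₃ h₄
  have hkk : star k * k = 1 - h ^ N * h ^ N := by rw [hs] at hk; rw [← hk]; noncomm_ring
  rw [hs, hkk]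
  -- The terms contribute, in order, `‖z‖ / (2N + 1)`, `r`, `2Nε`, `ε` and `2Nε`.
  have e : h ^ N * (star c * (z • c + y)) * h ^ N + z • (1 - h ^ N * h ^ N) - (z • 1 + x) =
      -(z • (h ^ (2 * N) * (1 - h))) + (h ^ N * (star c * (y - x)) * h ^ N +
        (h ^ N * (star c * (x * h ^ N - x)) + (h ^ N * (star c * x - x) + (h ^ N * x - x)))) := by
    have e1 : h ^ N * (star c * (z • c + y)) * h ^ N =
        z • (h ^ N * h * h ^ N) + h ^ N * (star c * y) * h ^ N := by
      rw [mul_add, mul_smul_comm, ← hh, mul_add, mul_smul_comm, add_mul, smul_mul_assoc]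
    have e2 : h ^ N * h * h ^ N = h ^ (2 * N) * h := by
      rw [← pow_succ, ← pow_add, ← pow_succ]; congr 1; omega
    rw [e1, e2, mul_sub, mul_one, smul_sub, smul_sub, two_mul, pow_add]
    noncomm_ring
  rw [e]
  have b1 : ‖-(z • (h ^ (2 * N) * (1 - h)))‖ ≤ ‖z‖ / (2 * N + 1) := by
    rw [norm_neg, norm_smul, div_eq_mul_one_div]
    have := norm_pow_mul_one_sub_le h0 h1 (2 * N)
    push_cast at this
    gcongr
  have b2 : ‖h ^ N * (star c * (y - x)) * h ^ N‖ ≤ r :=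
    ((norm_mul_le_of_norm_le_one' hln).trans ((norm_mul_le_of_norm_le_one hln).trans
      (norm_mul_le_of_norm_le_one hcs))).trans hy
  have b3 : ‖h ^ N * (star c * (x * h ^ N - x))‖ ≤ N * (2 * ε) :=
    ((norm_mul_le_of_norm_le_one hln).trans (norm_mul_le_of_norm_le_one hcs)).trans hxl
  have b4 : ‖h ^ N * (star c * x - x)‖ ≤ ε := (norm_mul_le_of_norm_le_one hln).trans h₂
  have t1 := norm_add_le (-(z • (h ^ (2 * N) * (1 - h)))) (h ^ N * (star c * (y - x)) * h ^ N +
        (h ^ N * (star c * (x * h ^ N - x)) + (h ^ N * (star c * x - x) + (h ^ N * x - x))))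
  have t2 := norm_add_le (h ^ N * (star c * (y - x)) * h ^ N)
        (h ^ N * (star c * (x * h ^ N - x)) + (h ^ N * (star c * x - x) + (h ^ N * x - x)))
  have t3 := norm_add_le (h ^ N * (star c * (x * h ^ N - x)))
    (h ^ N * (star c * x - x) + (h ^ N * x - x))
  have t4 := norm_add_le (h ^ N * (star c * x - x)) (h ^ N * x - x)
  linarith

theorem exists_completion {c : D} (hc : ‖c‖ ≤ 1) (N : ℕ) :
    ∃ k : D, star ((star c * c) ^ N) * (star c * c) ^ N + star k * k = 1 := by
  let _ := CStarAlgebra.spectralOrder D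
  have _ := CStarAlgebra.spectralOrderedRing D
  have hl : ‖(star c * c) ^ N‖ ≤ 1 := by
    rcases subsingleton_or_nontrivial D with hD | hD
    · rw [Subsingleton.elim ((star c * c) ^ N) 0, norm_zero]; exact zero_le_one
    · refine (norm_pow_le _ N).trans (pow_le_one₀ (norm_nonneg _) ?_)
      rw [CStarRing.norm_star_mul_self]
      exact mul_le_one₀ hc (norm_nonneg _) hc
  have : star ((star c * c) ^ N) * (star c * c) ^ N ≤ 1 := by
    rw [← CStarAlgebra.norm_le_one_iff_of_nonneg _ (star_mul_self_nonneg _),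
      CStarRing.norm_star_mul_self]
    exact mul_le_one₀ hl (norm_nonneg _) hl
  obtain ⟨k, hk⟩ := CStarAlgebra.nonneg_iff_eq_star_mul_self.1 (sub_nonneg.2 this)
  exact ⟨k, by rw [← hk]; abel⟩

/-- Numerical core of the convexity argument: `p` and `q` bound two vectors of sum `2w` and
difference `d`. A midpoint almost as long as `u` leaves little room for `d`. -/
theorem sq_le_of_parallelogram {s a u p q d w : ℝ} (hs1 : s ^ 2 ≤ 1)
    (hu : 0 ≤ u) (hua : u ≤ a) (hp0 : 0 ≤ p) (hq0 : 0 ≤ q) (hp : p ≤ u)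
    (hq : q ≤ (1 + 2 * s ^ 2) * u) (hw : u - 2 * s ^ 2 * a ≤ w)
    (hpar : (2 * w) ^ 2 + d ^ 2 = 2 * (p ^ 2 + q ^ 2)) : d ^ 2 ≤ 32 * s ^ 2 * a ^ 2 := by
  have ha0 : 0 ≤ a := hu.trans hua
  have hwsq : u ^ 2 - 4 * s ^ 2 * a * u ≤ w ^ 2 := by
    rcases le_total (2 * s ^ 2 * a) u with h | h
    · have := pow_le_pow_left₀ (sub_nonneg.2 h) hw 2
      have h' := sq_nonneg (2 * s ^ 2 * a)
      linear_combination this + h'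
    · have h1 : u * u ≤ u * (2 * s ^ 2 * a) := mul_le_mul_of_nonneg_left h hu
      have h2 : 0 ≤ u * (2 * s ^ 2 * a) := by positivity
      have h3 := sq_nonneg w
      linear_combination h1 + h2 + h3
  have hu2 : u ^ 2 ≤ a ^ 2 := pow_le_pow_left₀ hu hua 2
  have hp2 : p ^ 2 ≤ u ^ 2 := pow_le_pow_left₀ hp0 hp 2
  have hq2 : q ^ 2 ≤ ((1 + 2 * s ^ 2) * u) ^ 2 := pow_le_pow_left₀ hq0 hq 2
  have hua' : u * a ≤ a ^ 2 := by
    rw [pow_two]; exact mul_le_mul_of_nonneg_right hua ha0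
  have hs4 : s ^ 2 * s ^ 2 ≤ s ^ 2 := mul_le_of_le_one_left (sq_nonneg s) hs1
  have e3 : s ^ 2 * u ^ 2 ≤ s ^ 2 * a ^ 2 := mul_le_mul_of_nonneg_left hu2 (sq_nonneg s)
  have e4 : s ^ 2 * s ^ 2 * u ^ 2 ≤ s ^ 2 * a ^ 2 :=
    mul_le_mul hs4 hu2 (sq_nonneg _) (sq_nonneg _)
  have e5 : s ^ 2 * (u * a) ≤ s ^ 2 * a ^ 2 := mul_le_mul_of_nonneg_left hua' (sq_nonneg s)
  linear_combination hpar + 4 * hwsq + 2 * hp2 + 2 * hq2 + 8 * e3 + 8 * e4 + 16 * e5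

theorem norm_sub_le_of_midpoint {H : Type*} [NormedAddCommGroup H] [InnerProductSpace ℂ H]
    {p w u : H} {a s : ℝ} (hs0 : 0 ≤ s) (hs1 : s ≤ 1)
    (hp : ‖p‖ ≤ ‖u‖) (hq : ‖(2 : ℂ) • w - p‖ ≤ (1 + 2 * s ^ 2) * ‖u‖) (hu : ‖u‖ ≤ a)
    (hm : ‖w - u‖ ≤ 2 * s ^ 2 * a) : ‖p - u‖ ≤ 5 * (s * a) := by
  have ha0 : 0 ≤ a := (norm_nonneg _).trans hu
  have hs2 : s ^ 2 ≤ 1 := pow_le_one₀ hs0 hs1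
  have hpar := parallelogram_law_with_norm ℂ p ((2 : ℂ) • w - p)
  rw [add_sub_cancel, norm_smul, Complex.norm_ofNat] at hpar
  have htu : ‖u‖ - 2 * s ^ 2 * a ≤ ‖w‖ := by
    have := norm_sub_norm_le u (u - w)
    rw [sub_sub_cancel, norm_sub_rev] at this
    linarith
  have hdsq := sq_le_of_parallelogram hs2 (norm_nonneg u) hu (norm_nonneg p) (norm_nonneg _)
    hp hq htu hpar
  have hd6 : ‖p - ((2 : ℂ) • w - p)‖ ≤ 6 * (s * a) := by
    refine (pow_le_pow_iff_left₀ (norm_nonneg _) (by positivity) two_ne_zero).1 ?_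
    refine hdsq.trans ?_
    have : 0 ≤ s ^ 2 * a ^ 2 := by positivity
    linear_combination 4 * this
  have e : p - u = (1 / 2 : ℂ) • (p - ((2 : ℂ) • w - p)) + (w - u) := by module
  rw [e]
  refine (norm_add_le _ _).trans ?_
  have h3 : ‖(1 / 2 : ℂ)‖ = 1 / 2 := by simp
  rw [norm_smul, h3]
  have h4 : s ^ 2 * a ≤ s * a := by
    refine mul_le_mul_of_nonneg_right ?_ ha0
    rw [pow_two]; exact mul_le_of_le_one_left hs0 hs1
  linarith

/-- If the contractions `c` and (almost) `2 t - c` have a midpoint `t` that almost fixes `x`, so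
does `c`, by uniform convexity. -/
theorem norm_mul_sub_le_of_midpoint {H : Type*} [NormedAddCommGroup H]
    [InnerProductSpace ℂ H] {c t x : H →L[ℂ] H} {C s : ℝ} (hs0 : 0 ≤ s) (hs1 : s ≤ 1)
    (hc : ‖c‖ ≤ 1) (ht : ‖(2 : ℂ) • t - c‖ ≤ 1 + 2 * s ^ 2) (hx : ‖x‖ ≤ C)
    (htx : ‖t * x - x‖ ≤ 2 * s ^ 2 * C) : ‖c * x - x‖ ≤ 5 * C * s := by
  have hC : 0 ≤ C := (norm_nonneg _).trans hx
  refine ContinuousLinearMap.opNorm_le_bound _ (by positivity) fun v => ?_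
  have h1 : ‖c (x v)‖ ≤ ‖x v‖ := by
    have := c.le_of_opNorm_le hc (x v)
    rwa [one_mul] at this
  have h2 : ‖(2 : ℂ) • t (x v) - c (x v)‖ ≤ (1 + 2 * s ^ 2) * ‖x v‖ :=
    ContinuousLinearMap.le_of_opNorm_le _ ht (x v)
  have h3 : ‖t (x v) - x v‖ ≤ 2 * s ^ 2 * (C * ‖v‖) := by
    rw [← mul_assoc]
    exact ContinuousLinearMap.le_of_opNorm_le _ htx v
  have h4 := norm_sub_le_of_midpoint hs0 hs1 h1 h2 (x.le_of_opNorm_le hx v) h3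
  calc ‖(c * x - x) v‖ ≤ 5 * (s * (C * ‖v‖)) := h4
    _ = 5 * C * s * ‖v‖ := by ring

/-- For a contraction, `‖c⋆u - u‖² ≤ 2‖u‖² - 2 Re⟨u, c u⟩`, which is small once `c u` is near `u`.
-/
theorem norm_star_mul_sub_sq_le {H : Type*} [NormedAddCommGroup H] [InnerProductSpace ℂ H]
    [CompleteSpace H] {c x : H →L[ℂ] H} (hc : ‖c‖ ≤ 1) :
    ‖star c * x - x‖ ^ 2 ≤ 2 * ‖x‖ * ‖c * x - x‖ := by
  have h0 : 0 ≤ 2 * ‖x‖ * ‖c * x - x‖ := by positivity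
  rw [← Real.le_sqrt (norm_nonneg _) h0]
  refine ContinuousLinearMap.opNorm_le_bound _ (Real.sqrt_nonneg _) fun v => ?_
  refine abs_le_of_sq_le_sq' (a := ‖(star c * x - x) v‖) ?_ (by positivity) |>.2
  rw [mul_pow, Real.sq_sqrt h0]
  have hcs : ‖star c‖ ≤ 1 := by rwa [norm_star]
  set u := x v with hu
  have hun : ‖u‖ ≤ ‖x‖ * ‖v‖ := x.le_opNorm v
  have hcu : ‖c u - u‖ ≤ ‖c * x - x‖ * ‖v‖ := (c * x - x).le_opNorm v
  have hsu : ‖(star c) u‖ ≤ ‖u‖ := by simpa using ContinuousLinearMap.le_of_opNorm_le _ hcs u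
  have e : (star c * x - x) v = (star c) u - u := rfl
  rw [e, @norm_sub_sq ℂ, ContinuousLinearMap.star_eq_adjoint,
    ContinuousLinearMap.adjoint_inner_left, ← ContinuousLinearMap.star_eq_adjoint]
  have h2 : RCLike.re (inner ℂ u (c u)) = ‖u‖ ^ 2 + RCLike.re (inner ℂ u (c u - u)) := by
    rw [inner_sub_right, map_sub, ← @inner_self_eq_norm_sq ℂ]; ring
  have h3 : -RCLike.re (inner ℂ u (c u - u)) ≤ ‖u‖ * ‖c u - u‖ :=
    (neg_le_abs _).trans ((RCLike.abs_re_le_norm _).trans (norm_inner_le_norm _ _))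
  have h4 : ‖(star c) u‖ ^ 2 ≤ ‖u‖ ^ 2 := pow_le_pow_left₀ (norm_nonneg _) hsu 2
  have h5 : ‖u‖ * ‖c u - u‖ ≤ (‖x‖ * ‖v‖) * (‖c * x - x‖ * ‖v‖) :=
    mul_le_mul hun hcu (norm_nonneg _) (by positivity)
  rw [h2]
  nlinarith

end Estimates

/-! ### Approximate units of finite sets. -/

section ApproximateUnit

variable {A : Type*} [NonUnitalCStarAlgebra A]

/-- A finite set has an approximate unit `e` with `0 ≤ e ≤ 1`; positivity enters through
`‖2 e - 1‖ ≤ 1`. -/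
theorem exists_approximate_unit (S : Finset A) {η : ℝ} (hη : 0 < η) :
    ∃ e : A, ‖e‖ ≤ 1 ∧ ‖(2 : ℂ) • (e : Unitization ℂ A) - 1‖ ≤ 1 ∧
      ∀ a ∈ S, ‖e * a - a‖ ≤ η ∧ ‖a * e - a‖ ≤ η := by
  let _ := CStarAlgebra.spectralOrder A
  have _ := CStarAlgebra.spectralOrderedRing A
  let _ := CStarAlgebra.spectralOrder (Unitization ℂ A)
  have _ := CStarAlgebra.spectralOrderedRing (Unitization ℂ A)
  have hu := CStarAlgebra.increasingApproximateUnit (A := A)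
  have hne := hu.neBot
  have h₁ : ∀ᶠ e in CStarAlgebra.approximateUnit A, ∀ a ∈ S, ‖e * a - a‖ ≤ η ∧ ‖a * e - a‖ ≤ η := by
    rw [Filter.eventually_all_finset]
    intro a _
    have l := (hu.tendsto_mul_left a).sub_const a
    have r := (hu.tendsto_mul_right a).sub_const a
    rw [sub_self] at l r
    filter_upwards [l.norm.eventually_lt_const (u := η) (by simpa),
      r.norm.eventually_lt_const (u := η) (by simpa)] with e h h'
    exact ⟨by first | exact h.le | exact h'.le, by first | exact h'.le | exact h.le⟩
  obtain ⟨e, he, h0, hn⟩ := (h₁.and (hu.eventually_nonneg.and hu.eventually_norm)).exists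
  refine ⟨e, hn, ?_, he⟩
  have h0' : 0 ≤ (e : Unitization ℂ A) := Unitization.inr_nonneg_iff.2 h0
  have h1' : (e : Unitization ℂ A) ≤ 1 :=
    (CStarAlgebra.norm_le_one_iff_of_nonneg _ h0').1 (by rwa [Unitization.norm_inr])
  set E := (e : Unitization ℂ A) with hE
  have hEs : star E = E := (IsSelfAdjoint.of_nonneg h0').star_eq
  set d := (2 : ℂ) • E - 1 with hd
  have hds : star d = d := by
    rw [hd, star_sub, star_smul, hEs, star_one]; simp
  -- `(2E - 1)² = 1 - 4(E - E²)`, and `E² ≤ E`.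
  have hsq : star d * d = 1 - (4 : ℂ) • (E - E * E) := by
    rw [hds, hd, sub_mul, mul_sub, smul_mul_smul_comm, one_mul, mul_one]
    module
  have hEE : E * E ≤ E := by
    have := CStarAlgebra.pow_antitone h0' h1' (show 1 ≤ 2 by norm_num)
    simpa [pow_two] using this
  have hle : star d * d ≤ 1 := by
    rw [hsq]
    refine sub_le_self _ ?_
    have h4 : (4 : ℂ) • (E - E * E) = (4 : ℝ) • (E - E * E) := by
      rw [← Complex.coe_smul]; norm_num
    rw [h4]
    exact smul_nonneg (by norm_num) (sub_nonneg.2 hEE)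
  rw [← CStarAlgebra.norm_le_one_iff_of_nonneg _ (star_mul_self_nonneg _),
    CStarRing.norm_star_mul_self] at hle
  nlinarith [norm_nonneg d]

end ApproximateUnit

/-! ### The rank in the unitization. -/

section UnitizationRank

variable {A : Type*} [NonUnitalCStarAlgebra A]
  {H : Type*} [NormedAddCommGroup H] [InnerProductSpace ℂ H] [CompleteSpace H]

theorem norm_mul_mul_sub_le {f x : A} {η : ℝ} (hf : ‖f‖ ≤ 1) (h₁ : ‖f * x - x‖ ≤ η / 2)
    (h₂ : ‖x * f - x‖ ≤ η / 2) : ‖f * x * f - x‖ ≤ η := by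
  have e : f * x * f - x = f * (x * f - x) + (f * x - x) := by noncomm_ring
  rw [e]
  refine (norm_add_le _ _).trans ?_
  have : ‖f * (x * f - x)‖ ≤ ‖x * f - x‖ :=
    (norm_mul_le _ _).trans (mul_le_of_le_one_left (norm_nonneg _) hf)
  linarith

theorem norm_two_smul_sub_mul_self_le {e f : A} {η : ℝ} (hf : ‖f‖ ≤ 1)
    (he : ‖(2 : ℂ) • (e : Unitization ℂ A) - 1‖ ≤ 1) (h : ‖f * e * f - e‖ ≤ η) :
    ‖(2 : ℂ) • e - f * f‖ ≤ 1 + 2 * η := by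
  rw [← Unitization.norm_inr (𝕜 := ℂ)]
  have hf' : ‖(f : Unitization ℂ A)‖ ≤ 1 := by rwa [Unitization.norm_inr]
  have h' : ‖((f * e * f - e : A) : Unitization ℂ A)‖ ≤ η := by rwa [Unitization.norm_inr]
  have key : (((2 : ℂ) • e - f * f : A) : Unitization ℂ A) =
      f * ((2 : ℂ) • (e : Unitization ℂ A) - 1) * f
        - (2 : ℂ) • ((f * e * f - e : A) : Unitization ℂ A) := by
    simp only [Unitization.inr_sub, Unitization.inr_smul, Unitization.inr_mul, mul_sub, sub_mul,
      mul_one, mul_smul_comm, smul_mul_assoc, smul_sub]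
    abel
  rw [key]
  refine (norm_sub_le _ _).trans (add_le_add ?_ ?_)
  · exact (norm_mul_le_of_norm_le_one' hf').trans ((norm_mul_le_of_norm_le_one hf').trans he)
  · rw [norm_smul, Complex.norm_ofNat]
    linarith

theorem iterate_apply_eq {α : A ≃⋆ₐ[ℂ] A} {α' : Unitization ℂ A ≃⋆ₐ[ℂ] Unitization ℂ A}
    (hα : ∀ a : A, α' (Unitization.inr a) = Unitization.inr (α a)) (n : ℕ)
    (b : Unitization ℂ A) :
    (⇑α')^[n] b = algebraMap ℂ _ b.fst + ((⇑α)^[n] b.snd : A) := by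
  have h1 : ∀ z : ℂ, α' (algebraMap ℂ _ z) = algebraMap ℂ _ z := fun z => by
    rw [Algebra.algebraMap_eq_smul_one, map_smul, map_one]
  induction n with
  | zero =>
    conv_lhs => rw [← Unitization.inl_fst_add_inr_snd_eq b]
    rfl
  | succ n ih =>
    rw [Function.iterate_succ_apply', ih, map_add, h1, hα, Function.iterate_succ_apply']

/-- A contraction `c` that arises from a contractive `T` and an approximate unit is an approximate
unit for those elements that have an approximate unit `e` on which `T` is almost isometric. -/
theorem norm_mul_sub_le_of_contraction {π : A →⋆ₙₐ[ℂ] (H →L[ℂ] H)}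
    {T : A →ₗ[ℂ] (H →L[ℂ] H)} (hT : ∀ a, ‖T a‖ ≤ ‖a‖) {e f x : A} {C s ε : ℝ} (hs0 : 0 ≤ s)
    (hs1 : s ≤ 1) (hC : 1 ≤ C) (hε : 0 ≤ ε) (hsε : 5 * C * s ≤ ε)
    (hsε' : 2 * C * (5 * C * s) ≤ ε ^ 2) (hf : ‖f‖ ≤ 1)
    (he : ‖(2 : ℂ) • (e : Unitization ℂ A) - 1‖ ≤ 1) (hfe : ‖f * e * f - e‖ ≤ s ^ 2)
    (hTe : ‖T e - π e‖ ≤ s ^ 2) (hx : ‖x‖ ≤ C) (hex : ‖e * x - x‖ ≤ s ^ 2) :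
    ‖T (f * f) * π x - π x‖ ≤ ε ∧ ‖star (T (f * f)) * π x - π x‖ ≤ ε := by
  have hff : ‖f * f‖ ≤ 1 := (norm_mul_le _ _).trans (mul_le_one₀ hf (norm_nonneg _) hf)
  have hc : ‖T (f * f)‖ ≤ 1 := (hT _).trans hff
  have hπx : ‖π x‖ ≤ C := (NonUnitalStarAlgHom.norm_apply_le π x).trans hx
  have h1 : ‖T (f * f) * π x - π x‖ ≤ 5 * C * s := by
    refine norm_mul_sub_le_of_midpoint (t := T e) hs0 hs1 hc ?_ hπx ?_
    · rw [← map_smul, ← map_sub]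
      exact (hT _).trans (norm_two_smul_sub_mul_self_le hf he hfe)
    · have e1 : T e * π x - π x = (T e - π e) * π x + π (e * x - x) := by
        rw [map_sub, map_mul]; noncomm_ring
      rw [e1]
      refine (norm_add_le _ _).trans ?_
      have e2 : ‖(T e - π e) * π x‖ ≤ s ^ 2 * C :=
        (norm_mul_le _ _).trans (mul_le_mul hTe hπx (norm_nonneg _) (sq_nonneg s))
      have e3 : ‖π (e * x - x)‖ ≤ s ^ 2 := (NonUnitalStarAlgHom.norm_apply_le π _).trans hex
      have e4 : s ^ 2 ≤ s ^ 2 * C := le_mul_of_one_le_right (sq_nonneg s) hC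
      linarith
  refine ⟨h1.trans hsε, ?_⟩
  refine (pow_le_pow_iff_left₀ (norm_nonneg _) hε two_ne_zero).1 ?_
  refine (norm_star_mul_sub_sq_le hc).trans (le_trans ?_ hsε')
  have : 0 ≤ 2 * C := by linarith
  gcongr

theorem exists_small_parameter {C ε δ : ℝ} (hC : 1 ≤ C) (hε : 0 < ε) (hδ : 0 < δ) :
    ∃ s : ℝ, 0 < s ∧ s ≤ 1 ∧ 5 * C * s ≤ ε ∧ 2 * C * (5 * C * s) ≤ ε ^ 2 ∧ 2 * s ^ 2 ≤ δ := by
  have hC0 : 0 < C := by linarith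
  refine ⟨min (min 1 (ε / (5 * C))) (min (ε ^ 2 / (10 * C ^ 2)) (δ / 2)), by positivity,
    (min_le_left _ _).trans (min_le_left _ _), ?_, ?_, ?_⟩
  all_goals set s := min (min 1 (ε / (5 * C))) (min (ε ^ 2 / (10 * C ^ 2)) (δ / 2)) with hs
  · have : s ≤ ε / (5 * C) := (min_le_left _ _).trans (min_le_right _ _)
    rw [le_div_iff₀ (by positivity)] at this
    linarith
  · have : s ≤ ε ^ 2 / (10 * C ^ 2) := (min_le_right _ _).trans (min_le_left _ _)
    rw [le_div_iff₀ (by positivity)] at this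
    linarith
  · have h1 : s ≤ δ / 2 := (min_le_right _ _).trans (min_le_right _ _)
    have h2 : s ≤ 1 := (min_le_left _ _).trans (min_le_left _ _)
    have h3 : 0 ≤ s := by positivity
    nlinarith

open Classical in
/-- Passing from `A` to its unitization costs a single dimension, up to a fixed change of the finite
set and the tolerance. -/
theorem exists_rcc_unitization_le {α : A ≃⋆ₐ[ℂ] A}
    {α' : Unitization ℂ A ≃⋆ₐ[ℂ] Unitization ℂ A}
    (hα : ∀ a : A, α' (Unitization.inr a) = Unitization.inr (α a))
    {π : A →⋆ₙₐ[ℂ] (H →L[ℂ] H)} (hπ : Function.Injective π) (ω : Finset (Unitization ℂ A))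
    {δ : ℝ} (hδ : 0 < δ) :
    ∃ ω₀ : Finset A, ∃ δ₀ : ℝ, 0 < δ₀ ∧ ∀ n : ℕ,
      rcc (Unitization.starLift π : Unitization ℂ A →⋆ₙₐ[ℂ] (H →L[ℂ] H))
        (⋃ i < n, (⇑α')^[i] '' (ω : Set (Unitization ℂ A))) δ ≤
      rcc π (⋃ i < n, (⇑α)^[i] '' (ω₀ : Set A)) δ₀ + 1 := by
  obtain ⟨C₀, hC₀⟩ := (ω.image fun b => ‖b.snd‖).exists_le
  obtain ⟨Z₀, hZ₀⟩ := (ω.image fun b => ‖b.fst‖).exists_le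
  let C := max 1 C₀
  let Z := max 0 Z₀
  have hC : ∀ b ∈ ω, ‖b.snd‖ ≤ C := fun b hb =>
    (hC₀ _ (Finset.mem_image_of_mem _ hb)).trans (le_max_right _ _)
  have hZ : ∀ b ∈ ω, ‖b.fst‖ ≤ Z := fun b hb =>
    (hZ₀ _ (Finset.mem_image_of_mem _ hb)).trans (le_max_right _ _)
  have hC1 : 1 ≤ C := le_max_left _ _
  have hZ1 : 0 ≤ Z := le_max_left _ _
  -- The error budget is `δ / 4` each for the scalar part, the approximation `2 s²`, and the `(4N +
  -- 1) ε` from almost fixing. All of `N`, `ε`, `s`, `e` are chosen before `n`.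
  obtain ⟨N, hN⟩ := exists_nat_gt (4 * Z / δ)
  have hN' : Z / (2 * N + 1) ≤ δ / 4 := by
    rw [div_lt_iff₀ hδ] at hN
    rw [div_le_iff₀ (by positivity)]
    nlinarith [(Nat.cast_nonneg N : (0 : ℝ) ≤ N)]
  let ε := δ / (4 * (4 * N + 1))
  have hε : 0 < ε := by positivity
  have hε' : (4 * N + 1) * ε = δ / 4 := by
    simp only [ε]; field_simp
  obtain ⟨s, hs0, hs1, hsε, hsε', hsδ⟩ := exists_small_parameter hC1 hε
    (show 0 < δ / 4 by positivity)
  have hη : 0 < s ^ 2 := by positivity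
  let S := ω.image fun b => b.snd
  -- Adjoints are included because right multiplication is handled by passing to adjoints.
  obtain ⟨e, -, he2, heS⟩ := exists_approximate_unit (S ∪ S.image star) hη
  refine ⟨insert e S, s ^ 2, hη, fun n => ?_⟩
  by_cases htop : rcc π (⋃ i < n, (⇑α)^[i] '' ((insert e S : Finset A) : Set A)) (s ^ 2) = ⊤
  · rw [htop]; simp
  obtain ⟨m, -, hm, φ, ψ, hφ, hψ, happ⟩ := exists_factorization_of_rcc_ne_top htop
  rw [hm]
  let T : A →ₗ[ℂ] (H →L[ℂ] H) := ψ ∘ₗ φ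
  have hT : ∀ a, ‖T a‖ ≤ ‖a‖ := (hψ.comp hφ).norm_le
  have hTπ : ∀ i < n, ∀ a ∈ insert e S, ‖T ((⇑α)^[i] a) - π ((⇑α)^[i] a)‖ ≤ s ^ 2 :=
    fun i hi a ha => (happ _ (Set.mem_biUnion (Set.mem_ofPred.2 hi) ⟨a, ha, rfl⟩)).le
  -- Unlike `e`, this approximate unit depends on `n`.
  obtain ⟨f, hf, -, hfS⟩ := exists_approximate_unit
    ((Finset.range n).biUnion fun i => (insert e S).image (⇑α)^[i]) (half_pos hη)
  have hfα : ∀ i < n, ∀ a ∈ insert e S, ‖f * (⇑α)^[i] a * f - (⇑α)^[i] a‖ ≤ s ^ 2 := by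
    intro i hi a ha
    have := hfS ((⇑α)^[i] a) (Finset.mem_biUnion.2
      ⟨i, Finset.mem_range.2 hi, Finset.mem_image_of_mem _ ha⟩)
    exact norm_mul_mul_sub_le hf this.1 this.2
  have hc : ‖T (f * f)‖ ≤ 1 :=
    (hT _).trans ((norm_mul_le _ _).trans (mul_le_one₀ hf (norm_nonneg _) hf))
  obtain ⟨k, hk⟩ := exists_completion hc N
  refine rcc_unitization_le hπ hφ hψ hf (c := star (T (f * f))) (by rwa [norm_star]) hk ?_
  rintro _ hb
  simp only [Set.mem_iUnion] at hb
  obtain ⟨i, hi, b, hb, rfl⟩ := hb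
  have hbS : b.snd ∈ S := Finset.mem_image_of_mem _ hb
  rw [iterate_apply_eq hα]
  -- For `αⁱ b` the approximate unit is `αⁱ e`; automorphisms are isometric, so all its bounds carry
  -- over.
  have heα : ‖(2 : ℂ) • (((⇑α)^[i] e : A) : Unitization ℂ A) - 1‖ ≤ 1 := by
    have h1 := iterate_apply_eq hα i (e : Unitization ℂ A)
    rw [Unitization.fst_inr, Unitization.snd_inr, map_zero, zero_add] at h1
    rw [← h1, ← StarAlgEquiv.coe_pow, ← map_smul, ← map_one (α' ^ i), ← map_sub,
      StarAlgEquiv.norm_map]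
    exact he2
  have happ' : ∀ w ∈ S ∪ S.image star, ‖w‖ ≤ C →
      ‖T (f * f) * π ((⇑α)^[i] w) - π ((⇑α)^[i] w)‖ ≤ ε ∧
        ‖star (T (f * f)) * π ((⇑α)^[i] w) - π ((⇑α)^[i] w)‖ ≤ ε := by
    intro w hw hwC
    refine norm_mul_sub_le_of_contraction hT hs0.le hs1 hC1 hε.le hsε hsε' hf heα
      (hfα i hi e (Finset.mem_insert_self _ _)) (hTπ i hi e (Finset.mem_insert_self _ _)) ?_ ?_
    · rwa [← StarAlgEquiv.coe_pow, StarAlgEquiv.norm_map]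
    · rw [← StarAlgEquiv.coe_pow, ← map_mul, ← map_sub, StarAlgEquiv.norm_map]
      exact (heS w hw).1
  have hstar : star ((⇑α)^[i] b.snd) = (⇑α)^[i] (star b.snd) := by
    rw [← StarAlgEquiv.coe_pow, map_star]
  obtain ⟨h₁, h₂⟩ := happ' b.snd (Finset.mem_union_left _ hbS) (hC b hb)
  obtain ⟨h₃, h₄⟩ := happ' (star b.snd)
    (Finset.mem_union_right _ (Finset.mem_image_of_mem _ hbS)) (by rw [norm_star]; exact hC b hb)
  rw [← hstar, map_star] at h₃ h₄
  have hy : ‖T (f * (⇑α)^[i] b.snd * f) - π ((⇑α)^[i] b.snd)‖ ≤ 2 * s ^ 2 := by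
    have h5 := hTπ i hi b.snd (Finset.mem_insert_of_mem hbS)
    have h6 := (hT _).trans (hfα i hi b.snd (Finset.mem_insert_of_mem hbS))
    rw [map_sub] at h6
    refine (norm_sub_le_norm_sub_add_norm_sub _ (T ((⇑α)^[i] b.snd)) _).trans ?_
    linarith
  have main := norm_completion_sub_le (z := b.fst) hc h₁ h₂ h₃ h₄ hy hk
  have hz : ‖b.fst‖ / (2 * N + 1) ≤ δ / 4 :=
    (div_le_div_of_nonneg_right (hZ b hb) (by positivity)).trans hN'
  refine lt_of_eq_of_lt ?_ (main.trans_lt (show _ < δ by rw [hε']; linarith))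
  have hfst : (algebraMap ℂ (Unitization ℂ A) b.fst + ((⇑α)^[i] b.snd : A)).fst = b.fst := by
    simp [Unitization.algebraMap_eq_inl]
  have hsnd : (algebraMap ℂ (Unitization ℂ A) b.fst + ((⇑α)^[i] b.snd : A)).snd =
      (⇑α)^[i] b.snd := by
    simp [Unitization.algebraMap_eq_inl]
  have hcomp : ψ (φ (Unitization.compress f
      (algebraMap ℂ (Unitization ℂ A) b.fst + ((⇑α)^[i] b.snd : A)))) =
      b.fst • T (f * f) + T (f * (⇑α)^[i] b.snd * f) := by
    change T (_ • (f * f) + f * _ * f) = _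
    rw [hfst, hsnd, map_add, map_smul]
  rw [hcomp, hfst]
  congr 2
  change Unitization.starLift π _ = _
  rw [Unitization.starLift_apply', hfst, hsnd]

end UnitizationRank

/-! ### Comparison of entropies. -/

section Entropy

variable {A B : Type*} [NonUnitalCStarAlgebra A] [NonUnitalCStarAlgebra B]
  {H : Type*} [NormedAddCommGroup H] [InnerProductSpace ℂ H] [CompleteSpace H]
  {K : Type*} [NormedAddCommGroup K] [InnerProductSpace ℂ K] [CompleteSpace K]

theorem one_le_rcc (π : A →⋆ₙₐ[ℂ] (H →L[ℂ] H)) (S : Set A) (δ : ℝ) : 1 ≤ rcc π S δ := by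
  refine le_sInf ?_
  rintro _ ⟨m, hm, rfl, -⟩
  exact_mod_cast hm

theorem log_add_one_le {r : ℕ∞} (hr : 1 ≤ r) :
    ENNReal.log ((r + 1 : ℕ∞) : ℝ≥0∞) ≤ ENNReal.log 2 + ENNReal.log (r : ℝ≥0∞) := by
  rw [← ENNReal.log_mul_add]
  refine ENNReal.log_le_log ?_
  have : (r + 1 : ℕ∞) ≤ 2 * r := by rw [two_mul]; gcongr
  calc ((r + 1 : ℕ∞) : ℝ≥0∞) ≤ ((2 * r : ℕ∞) : ℝ≥0∞) := by exact_mod_cast this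
    _ = 2 * (r : ℝ≥0∞) := by simp

theorem limsup_log_div_le {u v : ℕ → ℕ∞} (hv : ∀ n, 1 ≤ v n) (h : ∀ n, u n ≤ v n + 1) :
    Filter.limsup (fun n : ℕ => ENNReal.log (u n : ℝ≥0∞) / n) Filter.atTop ≤
      Filter.limsup (fun n : ℕ => ENNReal.log (v n : ℝ≥0∞) / n) Filter.atTop := by
  have hlim : Filter.limsup (fun n : ℕ => ENNReal.log 2 / (n : EReal)) Filter.atTop = 0 := by
    refine (EReal.tendsto_const_div_atTop_nhds_zero_nat ?_ ?_).limsup_eq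
    · simp
    · simp
  calc Filter.limsup (fun n : ℕ => ENNReal.log (u n : ℝ≥0∞) / n) Filter.atTop
      ≤ Filter.limsup ((fun n : ℕ => ENNReal.log 2 / (n : EReal)) +
          fun n : ℕ => ENNReal.log (v n : ℝ≥0∞) / n) Filter.atTop := by
        refine Filter.limsup_le_limsup (Filter.Eventually.of_forall fun n => ?_)
        have hn : (0 : EReal) ≤ n := by positivity
        rw [Pi.add_apply, ← EReal.add_div_of_nonneg_right hn]
        refine EReal.div_le_div_right_of_nonneg hn (le_trans ?_ (log_add_one_le (hv n)))
        exact ENNReal.log_le_log (by exact_mod_cast h n)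
    _ ≤ _ := EReal.limsup_add_le (by simp [hlim]) (by simp [hlim])
    _ = _ := by rw [hlim, zero_add]

theorem ccEntropy_le_of_forall_rcc_le {ρ : B →⋆ₙₐ[ℂ] (K →L[ℂ] K)} {β : B ≃⋆ₐ[ℂ] B}
    {π : A →⋆ₙₐ[ℂ] (H →L[ℂ] H)} {α : A ≃⋆ₐ[ℂ] A}
    (h : ∀ (ω : Finset B) (δ : ℝ), 0 < δ → ∃ (ω₀ : Finset A) (δ₀ : ℝ), 0 < δ₀ ∧ ∀ n : ℕ,
      rcc ρ (⋃ i < n, (⇑β)^[i] '' (ω : Set B)) δ ≤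
        rcc π (⋃ i < n, (⇑α)^[i] '' (ω₀ : Set A)) δ₀ + 1) :
    ccEntropy ρ β ≤ ccEntropy π α := by
  refine iSup_le fun ω => iSup₂_le fun δ hδ => ?_
  obtain ⟨ω₀, δ₀, hδ₀, hn⟩ := h ω δ hδ
  refine (limsup_log_div_le (fun n => one_le_rcc _ _ _) hn).trans ?_
  exact (le_iSup₂ (f := fun (δ : ℝ) (_ : 0 < δ) => htAt π α ω₀ δ) δ₀ hδ₀).trans
    (le_iSup (fun ω => htOn π α ω) ω₀)

/-- The entropy decreases along a change of representation by a complete contraction. -/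
theorem ccEntropy_le_of_completeContraction {π : A →⋆ₙₐ[ℂ] (H →L[ℂ] H)}
    {ρ : A →⋆ₙₐ[ℂ] (K →L[ℂ] K)} {Θ : (H →L[ℂ] H) →ₗ[ℂ] (K →L[ℂ] K)}
    (hΘ : IsCompleteContraction Θ) (h : ∀ a, Θ (π a) = ρ a) (α : A ≃⋆ₐ[ℂ] A) :
    ccEntropy ρ α ≤ ccEntropy π α :=
  ccEntropy_le_of_forall_rcc_le fun ω δ hδ => ⟨ω, δ, hδ, fun _ =>
    (rcc_le_rcc (ι := LinearMap.id) (fun _ _ => le_rfl) hΘ (fun _ hb => hb)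
      fun b _ => h b).trans le_self_add⟩

open Classical in
theorem ccEntropy_inr_le {α : A ≃⋆ₐ[ℂ] A} {α' : Unitization ℂ A ≃⋆ₐ[ℂ] Unitization ℂ A}
    (hα : ∀ a : A, α' (Unitization.inr a) = Unitization.inr (α a))
    (σ : Unitization ℂ A →⋆ₙₐ[ℂ] (K →L[ℂ] K)) :
    ccEntropy (σ.comp (Unitization.inrNonUnitalStarAlgHom ℂ A)) α ≤ ccEntropy σ α' := by
  refine ccEntropy_le_of_forall_rcc_le fun ω δ hδ =>
    ⟨ω.image Unitization.inr, δ, hδ, fun n => le_trans ?_ le_self_add⟩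
  refine rcc_le_rcc (IsCompleteContraction.of_starHom (Unitization.inrNonUnitalStarAlgHom ℂ A))
    (Θ := LinearMap.id) (fun _ _ => le_rfl) ?_ fun b _ => rfl
  intro a ha
  simp only [Set.mem_iUnion] at ha ⊢
  obtain ⟨i, hi, b, hb, rfl⟩ := ha
  refine ⟨i, hi, Unitization.inr b, by simpa using hb, ?_⟩
  rw [iterate_apply_eq hα, Unitization.fst_inr, Unitization.snd_inr, map_zero, zero_add]
  rfl

/-- A faithful `σ` need not be unital; compressing the unital extension of its restriction to `A` by
`σ 1` recovers it. -/
theorem ccEntropy_le_starLift (α' : Unitization ℂ A ≃⋆ₐ[ℂ] Unitization ℂ A)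
    (σ : Unitization ℂ A →⋆ₙₐ[ℂ] (K →L[ℂ] K)) :
    ccEntropy σ α' ≤ ccEntropy (Unitization.starLift
      (σ.comp (Unitization.inrNonUnitalStarAlgHom ℂ A)) :
        Unitization ℂ A →⋆ₙₐ[ℂ] (K →L[ℂ] K)) α' := by
  have h1 : ‖σ 1‖ ≤ 1 := by
    refine (NonUnitalStarAlgHom.norm_apply_le σ 1).trans ?_
    rw [CStarRing.norm_one]
  let Θ : (K →L[ℂ] K) →ₗ[ℂ] (K →L[ℂ] K) :=
    { toFun X := σ 1 ∘L X ∘L σ 1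
      map_add' X Y := by ext; simp
      map_smul' c X := by ext; simp }
  refine ccEntropy_le_of_completeContraction (Θ := Θ) (IsCompleteContraction.compression h1 h1
    (φ := LinearMap.id) (fun _ _ => le_rfl) fun X => rfl) (fun b => ?_) α'
  change σ 1 * (Unitization.starLift _ b * σ 1) = σ b
  rw [Unitization.starLift_apply']
  change σ 1 * ((b.fst • 1 + σ (b.snd : Unitization ℂ A)) * σ 1) = σ b
  rw [add_mul, smul_mul_assoc, one_mul, mul_add, mul_smul_comm, ← map_mul, ← map_mul, ← map_mul,
    one_mul, mul_one, one_mul, ← map_smul, ← map_add]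
  congr 1
  conv_rhs => rw [← Unitization.inl_fst_add_inr_snd_eq b]
  rw [← Algebra.algebraMap_eq_smul_one]
  rfl

theorem Unitization.existsUnique_starAlgEquiv_extension (α : A ≃⋆ₐ[ℂ] A) :
    ∃! α' : Unitization ℂ A ≃⋆ₐ[ℂ] Unitization ℂ A,
      ∀ a : A, α' (Unitization.inr a) = Unitization.inr (α a) := by
  let F := Unitization.starMap (α.toNonUnitalStarAlgHom : A →⋆ₙₐ[ℂ] A)
  have hF : Function.Bijective F := ⟨Unitization.starMap_injective α.injective,
    Unitization.starMap_surjective α.surjective⟩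
  have hF' : ∀ a : A, StarAlgEquiv.ofBijective F hF (Unitization.inr a) = Unitization.inr (α a) :=
    fun a => Unitization.starMap_inr _ a
  refine ⟨StarAlgEquiv.ofBijective F hF, hF', fun α' hα' => ?_⟩
  ext b : 1
  -- At exponent `1` the formula determines an extension from `α`.
  have h1 := iterate_apply_eq hα' 1 b
  have h2 := iterate_apply_eq hF' 1 b
  rw [Function.iterate_one, Function.iterate_one] at h1 h2
  rw [h1, h2]

end Entropy

end

theorem theorem3p5 {A : Type*} [NonUnitalCStarAlgebra A]
    (hA : ¬ ∃ e : A, ∀ a : A, e * a = a ∧ a * e = a)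
    (α : A ≃⋆ₐ[ℂ] A) :
    (∃! α' : Unitization ℂ A ≃⋆ₐ[ℂ] Unitization ℂ A,
      ∀ a : A, α' (Unitization.inr a) = Unitization.inr (α a)) ∧
    ∀ α' : Unitization ℂ A ≃⋆ₐ[ℂ] Unitization ℂ A,
      (∀ a : A, α' (Unitization.inr a) = Unitization.inr (α a)) →
      ∀ {H : Type*} [NormedAddCommGroup H] [InnerProductSpace ℂ H] [CompleteSpace H]
        (π : A →⋆ₙₐ[ℂ] (H →L[ℂ] H)) (_ : Function.Injective π)
        {K : Type*} [NormedAddCommGroup K] [InnerProductSpace ℂ K] [CompleteSpace K]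
        (σ : Unitization ℂ A →⋆ₙₐ[ℂ] (K →L[ℂ] K)) (_ : Function.Injective σ),
        ccEntropy π α = ccEntropy σ α' := by
  refine ⟨Unitization.existsUnique_starAlgEquiv_extension α, ?_⟩
  intro α' hα' H _ _ _ π hπ K _ _ _ σ hσ
  have hρ : Function.Injective (σ.comp (Unitization.inrNonUnitalStarAlgHom ℂ A)) :=
    hσ.comp Unitization.inr_injective
  -- Both `π` and the restriction of `σ` are faithful, so each factors through the other and they
  -- give `α` the same entropy.
  obtain ⟨Θ, hΘ, hΘπ⟩ := exists_completeContraction_comp_eq hA hρ π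
  obtain ⟨Θ', hΘ', hΘρ⟩ := exists_completeContraction_comp_eq hA hπ
    (σ.comp (Unitization.inrNonUnitalStarAlgHom ℂ A))
  refine le_antisymm ?_ ?_
  · exact (ccEntropy_le_of_completeContraction hΘ hΘπ α).trans (ccEntropy_inr_le hα' σ)
  · refine (ccEntropy_le_starLift α' σ).trans
      (le_trans ?_ (ccEntropy_le_of_completeContraction hΘ' hΘρ α))
    exact ccEntropy_le_of_forall_rcc_le fun ω δ hδ => exists_rcc_unitization_le hα' hρ ω hδ
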